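/- Let $N\ge 2$, and let agent indices $i\in\{1,\dots,N\}$ be read cyclically modulo $N$. Let $L:\mathbb{R}^2\to\mathbb{R}$ be continuous, let the coverage region $\Omega=\{q\in\mathbb{R}^2: L(q)\le 0\}$ be bounded, and let $\rho$ be a measurable density with $0<\underline\rho\le\rho(q)\le\bar\rho$ for all $q\in\Omega$. For a state consisting of phase angles $\varphi=(\varphi_1,\dots,\varphi_N)\in\mathbb{R}^N$ (lifts of angles modulo $2\pi$, with the convention $\varphi_{N+1}=\varphi_1+2\pi$) and reference points $\mathbf r=(\mathbf r_1,\dots,\mathbf r_N)\in(\mathbb{R}^2)^N$, the subregion of agent $i$ is $$\Omega_i=\{q\in\Omega:\ q=\mathbf r_i+\kappa(\cos\theta,\sin\theta)\ \text{for some }\kappa\ge 0,\ \theta\in[\varphi_i,\varphi_{i+1}]\},$$ its workload is $m_i=\int_{\Omega_i}\rho(q)\,dq$, and its centroid is $c_{\Omega_i}=\frac{1}{m_i}\int_{\Omega_i}q\,\rho(q)\,dq$. Let $\kappa_\varphi,\kappa_r>0$, and let $(\varphi(t),\mathbf r(t))$, $t\ge 0$, be a solution of the partition dynamics $$\dot\varphi_i=-\kappa_\varphi\Big[(2m_i-m_{i-1}-m_{i+1})\frac{\partial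 m_i}{\partial\varphi_i}+(2m_{i-1}-m_{i-2}-m_i)\frac{\partial m_{i-1}}{\partial\varphi_i}\Big],$$ $$\dot{\mathbf r}_i=-\kappa_r\Big[(2m_i-m_{i-1}-m_{i+1})\Big(\frac{\partial m_i}{\partial\mathbf r_i}\Big)^{T}+2\mathbf r_i-\mathbf r_{i-1}-\mathbf r_{i+1}\Big]$$ such that 1. the pointers keep their cyclic order: $\varphi_1(t)<\varphi_2(t)<\dots<\varphi_N(t)<\varphi_1(t)+2\pi$ for all $t\ge 0$; 2. the reference points stay in the interior of $\Omega$, away from the boundary: there is a compact set $K\subset\operatorname{int}\Omega$ with $\mathbf r_i(t)\in K$ for all $t\ge 0$ and all $i$; 3. the two partition bars of each agent do not run along the boundary of $\Omega$ or along discontinuities of $\rho$: for all $t\ge 0$, all $i$ and $\theta\in\{\varphi_i(t),\varphi_{i+1}(t)\}$, for almost every $\kappa\ge 0$ the point $\mathbf r_i(t)+\kappa(\cos\theta,\sin\theta)$ either lies outside $\Omega$ or is an interior point of $\Omega$ at which $\rho$ is continuous. Then for every $i$ the centroid $t\mapsto c_{\Omega_i}(t)$ is differentiable on $[0,\infty)$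 (one-sidedly at $t=0$) and $$\lim_{t\to\infty}\dot c_{\Omega_i}(t)=\mathbf 0 .$$ -/

import Mathlib

open MeasureTheory Filter Topology

noncomputable section

/-- The Euclidean plane. -/
abbrev Plane : Type := EuclideanSpace ℝ (Fin 2)

/-- The coverage region `Ω = {q | L q ≤ 0}`. -/
def coverageRegion (L : Plane → ℝ) : Set Plane := {q | L q ≤ 0}

/-- The point `p + κ (cos θ, sin θ)` of the rotary pointer with reference point `p` and phase
angle `θ`. -/
def pointer (p : Plane) (θ κ : ℝ) : Plane := p + κ • !₂[Real.cos θ, Real.sin θ]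

/-- The closed sector with apex `p` swept counterclockwise from the angle `a` to the angle `b`:
the points that have a polar angle in `[a, b]` about `p`. -/
def sector (p : Plane) (a b : ℝ) : Set Plane :=
  {q | ∃ κ : ℝ, 0 ≤ κ ∧ ∃ θ ∈ Set.Icc a b, q = pointer p θ κ}

/-- The phase angle of the pointer that follows pointer `i` in the cyclic order. Angles are real
numbers (lifts of angles modulo `2π`), so one full turn is added after the last agent. -/
def nextAngle {N : ℕ} [NeZero N] (φ : Fin N → ℝ) (i : Fin N) : ℝ :=
  if (i : ℕ) + 1 = N then φ (i + 1) + 2 * Real.pi else φ (i + 1)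

/-- The subregion `Ω_i` of agent `i`. -/
def subregion {N : ℕ} [NeZero N] (L : Plane → ℝ) (φ : Fin N → ℝ) (r : Fin N → Plane)
    (i : Fin N) : Set Plane :=
  coverageRegion L ∩ sector (r i) (φ i) (nextAngle φ i)

/-- The workload `m_i = ∫_{Ω_i} ρ`. -/
def workload {N : ℕ} [NeZero N] (L ρ : Plane → ℝ) (φ : Fin N → ℝ) (r : Fin N → Plane)
    (i : Fin N) : ℝ :=
  ∫ q in subregion L φ r i, ρ q

/-- The centroid `c_{Ω_i} = (∫_{Ω_i} q ρ(q) dq) / (∫_{Ω_i} ρ(q) dq)`. -/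
def centroid {N : ℕ} [NeZero N] (L ρ : Plane → ℝ) (φ : Fin N → ℝ) (r : Fin N → Plane)
    (i : Fin N) : Plane :=
  (workload L ρ φ r i)⁻¹ • ∫ q in subregion L φ r i, ρ q • q

/-- The difference `2 m_i - m_{i-1} - m_{i+1}` (cyclic indices). -/
def workloadDiff {N : ℕ} [NeZero N] (L ρ : Plane → ℝ) (φ : Fin N → ℝ) (r : Fin N → Plane)
    (i : Fin N) : ℝ :=
  2 * workload L ρ φ r i - workload L ρ φ r (i - 1) - workload L ρ φ r (i + 1)

/-- The partial derivative `∂m_j / ∂φ_i`. -/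
def workloadAngleDeriv {N : ℕ} [NeZero N] (L ρ : Plane → ℝ) (φ : Fin N → ℝ)
    (r : Fin N → Plane) (j i : Fin N) : ℝ :=
  deriv (fun s : ℝ => workload L ρ (Function.update φ i s) r j) (φ i)

/-- The (transposed) partial derivative `(∂m_i / ∂r_i)ᵀ`, a vector of the plane. -/
def workloadPointGrad {N : ℕ} [NeZero N] (L ρ : Plane → ℝ) (φ : Fin N → ℝ)
    (r : Fin N → Plane) (i : Fin N) : Plane :=
  gradient (fun p : Plane => workload L ρ φ (Function.update r i p) i) (r i)

/-- `(φ, r)` solves the partition dynamics on `[0, ∞)` with gains `κφ` and `κr`. -/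
structure IsPartitionSolution {N : ℕ} [NeZero N] (L ρ : Plane → ℝ) (κφ κr : ℝ)
    (φ : ℝ → Fin N → ℝ) (r : ℝ → Fin N → Plane) : Prop where
  angle : ∀ t : ℝ, 0 ≤ t → ∀ i : Fin N,
    HasDerivWithinAt (fun s => φ s i)
      (-κφ * (workloadDiff L ρ (φ t) (r t) i * workloadAngleDeriv L ρ (φ t) (r t) i i
        + workloadDiff L ρ (φ t) (r t) (i - 1)
          * workloadAngleDeriv L ρ (φ t) (r t) (i - 1) i))
      (Set.Ici 0) t
  point : ∀ t : ℝ, 0 ≤ t → ∀ i : Fin N,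
    HasDerivWithinAt (fun s => r s i)
      (-κr • (workloadDiff L ρ (φ t) (r t) i • workloadPointGrad L ρ (φ t) (r t) i
        + ((2 : ℝ) • r t i - r t (i - 1) - r t (i + 1))))
      (Set.Ici 0) t

/-- The pointer with reference point `p` and angle `θ` is regular: almost every one of its points
(for the length) lies outside `Ω` or is an interior point of `Ω` at which `ρ` is continuous. Thus
the pointer does not run along the boundary of `Ω` or along a curve of discontinuities of `ρ`. -/
def RegularPointer (L ρ : Plane → ℝ) (p : Plane) (θ : ℝ) : Prop :=
  ∀ᵐ κ ∂(volume.restrict (Set.Ici (0 : ℝ))),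
    pointer p θ κ ∉ coverageRegion L ∨
      (pointer p θ κ ∈ interior (coverageRegion L) ∧ ContinuousAt ρ (pointer p θ κ))

end

/-! The flow is gradient descent, with positive gains, for the energy `V = Σ (m_i - m_{i+1})² + Σ
|r_i - r_{i+1}|²`, and along it `V' = -2 (Σ φ̇_i² / κφ + Σ |ṙ_i|² / κr)`. Barbalat's lemma cannot be
applied to the velocities themselves: the partial derivatives of the workloads are integrals along
bars of a density that is only measurable, so they are bounded but have no known modulus of
continuity in time. Instead it is applied to the cyclic second differences `D_i` of the workloads
and `E_i` of the reference points, which are Lipschitz in time because all velocities are bounded.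

The angular equations read `D_i (-∂m_i/∂φ_i) - D_{i-1} ∂m_{i-1}/∂φ_i = φ̇_i / κφ`. Discs of a fixed
radius about the reference points lie in `Ω`, so the coefficients are bounded above and away from
zero; since `Σ D_i = 0`, going once around the cycle bounds `D` by `φ̇` (`exists_cyclic_bound`).
Similarly `E` is bounded by `ṙ` and `D`. Hence `V` dissipates `|D|²` and `|E|²`, both tend to zero
(`tendsto_zero_of_dissipation`), and the equations of motion then force `φ̇` and `ṙ` to zero
(`tendsto_zero_of_cyclic_descent`).

The chain rule needs Fréchet differentiability of integrals over a sector in its apex and angles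
(`hasFDerivAt_sectorIntegral`). In polar coordinates about the unperturbed apex, a circle around
both apexes meets the perturbed sector in an arc with smoothly moving ends, so only continuity of
the integrand at almost every point of the two bars is needed.

Finally, the centroid is a quotient of two such integrals. Their time derivatives are uniformly
bounded linear maps applied to velocities tending to zero, and the denominator is eventually bounded
below: `D → 0` makes the workloads equalize, while their sum stays above a positive constant because
the sector angles add up to `2π`. -/

noncomputable section

/-! ### Circles cut by a sector whose apex is off centre. -/

/-- The unit vector of polar angle `θ`. -/
def unitVec (θ : ℝ) : Plane := !₂[Real.cos θ, Real.sin θ]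

/-- The unit vector of polar angle `θ + π / 2`. -/
def normalVec (θ : ℝ) : Plane := !₂[-Real.sin θ, Real.cos θ]

lemma pointer_eq (p : Plane) (θ κ : ℝ) : pointer p θ κ = p + κ • unitVec θ := rfl

lemma inner_normalVec (θ : ℝ) (h : Plane) :
    inner ℝ (normalVec θ) h = -Real.sin θ * h 0 + Real.cos θ * h 1 := by
  simp [normalVec, PiLp.inner_apply, Fin.sum_univ_two]
  ring

lemma norm_sq_plane (h : Plane) : ‖h‖ ^ 2 = h 0 ^ 2 + h 1 ^ 2 := by
  simp [EuclideanSpace.norm_sq_eq, Fin.sum_univ_two]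

lemma norm_unitVec (θ : ℝ) : ‖unitVec θ‖ = 1 := by
  have h : ‖unitVec θ‖ ^ 2 = 1 := by simp [norm_sq_plane, unitVec]
  exact (pow_eq_one_iff_of_nonneg (norm_nonneg _) two_ne_zero).1 h

lemma norm_normalVec (θ : ℝ) : ‖normalVec θ‖ = 1 := by
  have h : ‖normalVec θ‖ ^ 2 = 1 := by simp [norm_sq_plane, normalVec]
  exact (pow_eq_one_iff_of_nonneg (norm_nonneg _) two_ne_zero).1 h

lemma dist_pointer (p : Plane) (θ : ℝ) {κ : ℝ} (hκ : 0 ≤ κ) : dist (pointer p θ κ) p = κ := by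
  rw [pointer_eq, dist_eq_norm, add_sub_cancel_left, norm_smul, norm_unitVec, mul_one,
    Real.norm_of_nonneg hκ]

@[fun_prop]
lemma continuous_unitVec : Continuous unitVec := by
  unfold unitVec
  refine (PiLp.continuous_toLp 2 _).comp (continuous_pi fun i => ?_)
  fin_cases i <;> simp <;> fun_prop

@[fun_prop]
lemma continuous_normalVec : Continuous normalVec := by
  unfold normalVec
  refine (PiLp.continuous_toLp 2 _).comp (continuous_pi fun i => ?_)
  fin_cases i <;> simp <;> fun_prop

lemma continuous_pointer (p : Plane) : Continuous fun z : ℝ × ℝ => pointer p z.2 z.1 := by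
  simp only [pointer_eq]
  fun_prop

lemma unitVec_add_two_pi (θ : ℝ) : unitVec (θ + 2 * Real.pi) = unitVec θ := by
  simp [unitVec]

lemma normalVec_add_int_mul_two_pi (θ : ℝ) (k : ℤ) :
    normalVec (θ + k * (2 * Real.pi)) = normalVec θ := by
  simp [normalVec]

lemma exists_int_of_smul_unitVec_eq {s t a b : ℝ} (hs : 0 < s) (ht : 0 < t)
    (h : s • unitVec a = t • unitVec b) : s = t ∧ ∃ k : ℤ, a = b + k * (2 * Real.pi) := by
  have hst : s = t := by
    have := congrArg norm h
    simpa [norm_smul, norm_unitVec, abs_of_pos hs, abs_of_pos ht] using this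
  subst hst
  have h' : unitVec a = unitVec b := smul_right_injective _ hs.ne' h
  have h0 : Real.cos a = Real.cos b := by simpa [unitVec] using congrArg (fun q : Plane => q 0) h'
  have h1 : Real.sin a = Real.sin b := by simpa [unitVec] using congrArg (fun q : Plane => q 1) h'
  obtain ⟨k, hk⟩ := Real.Angle.angle_eq_iff_two_pi_dvd_sub.1 (Real.Angle.cos_sin_inj h0 h1)
  exact ⟨rfl, k, by linarith⟩

/-- The polar angle about `0` of the point where the ray from `h` in direction `ψ` meets the
circle of radius `κ` about `0`. -/
def circleAngle (h : Plane) (κ ψ : ℝ) : ℝ := ψ + Real.arcsin (inner ℝ (normalVec ψ) h / κ)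

lemma circleAngle_zero (κ ψ : ℝ) : circleAngle 0 κ ψ = ψ := by simp [circleAngle]

lemma continuous_circleAngle (h : Plane) (κ : ℝ) : Continuous (circleAngle h κ) := by
  unfold circleAngle
  have : Continuous fun ψ => inner ℝ (normalVec ψ) h / κ := by fun_prop
  exact continuous_id.add (Real.continuous_arcsin.comp this)

lemma circleAngle_add_int_mul_two_pi (h : Plane) (κ ψ : ℝ) (k : ℤ) :
    circleAngle h κ (ψ + k * (2 * Real.pi)) = circleAngle h κ ψ + k * (2 * Real.pi) := by
  simp only [circleAngle, normalVec_add_int_mul_two_pi]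
  ring

lemma abs_inner_normalVec_le (h : Plane) (ψ : ℝ) : |inner ℝ (normalVec ψ) h| ≤ ‖h‖ := by
  simpa [norm_normalVec] using abs_real_inner_le_norm (normalVec ψ) h

/-- In the orthonormal frame of direction `ψ`, `h` has coordinates `(c, s)` and the ray is
horizontal at height `s`. It meets the circle at `(κ cos α, s)` with `κ sin α = s`, so the travelled
length is `κ cos α - c`. It is positive because `c² + s² < κ²`. -/
lemma exists_circleAngle_eq {h : Plane} {κ : ℝ} (hκ : ‖h‖ < κ) (ψ : ℝ) :
    ∃ l : ℝ, 0 < l ∧ κ • unitVec (circleAngle h κ ψ) = h + l • unitVec ψ := by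
  have hκ0 : 0 < κ := (norm_nonneg h).trans_lt hκ
  set s : ℝ := inner ℝ (normalVec ψ) h with hs
  have hs' := inner_normalVec ψ h
  rw [← hs] at hs'
  have hsle : |s| ≤ ‖h‖ := abs_inner_normalVec_le h ψ
  obtain ⟨hs1, hs2⟩ := abs_le.1 (hsle.trans hκ.le)
  set α : ℝ := Real.arcsin (s / κ) with hα
  have hsin : κ * Real.sin α = s := by
    rw [hα, Real.sin_arcsin, mul_div_cancel₀ _ hκ0.ne']
    · rw [le_div_iff₀ hκ0]; linarith
    · rw [div_le_iff₀ hκ0]; linarith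
  have hcos : 0 ≤ Real.cos α := Real.cos_arcsin_nonneg _
  have hsc := Real.sin_sq_add_cos_sq ψ
  have hsca := Real.sin_sq_add_cos_sq α
  set c : ℝ := Real.cos ψ * h 0 + Real.sin ψ * h 1 with hc
  refine ⟨κ * Real.cos α - c, ?_, ?_⟩
  · have h1 : c ^ 2 + s ^ 2 = ‖h‖ ^ 2 := by
      rw [norm_sq_plane, hs', hc]
      linear_combination (h 0 ^ 2 + h 1 ^ 2) * hsc
    have h2 : c ^ 2 < (κ * Real.cos α) ^ 2 := by
      have : (κ * Real.cos α) ^ 2 + s ^ 2 = κ ^ 2 := by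
        rw [← hsin]; linear_combination κ ^ 2 * hsca
      have : ‖h‖ ^ 2 < κ ^ 2 := pow_lt_pow_left₀ hκ (norm_nonneg _) two_ne_zero
      linarith
    have := (abs_lt_of_sq_lt_sq h2 (by positivity))
    linarith [le_abs_self c]
  · have h0 : κ * Real.cos (ψ + α) = h 0 + (κ * Real.cos α - c) * Real.cos ψ := by
      rw [Real.cos_add, hc]
      have : -Real.sin ψ * s = h 0 - c * Real.cos ψ := by
        rw [hs', hc]; linear_combination h 0 * hsc
      rw [← hsin, hc] at this
      linear_combination this
    have h1 : κ * Real.sin (ψ + α) = h 1 + (κ * Real.cos α - c) * Real.sin ψ := by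
      rw [Real.sin_add, hc]
      have : Real.cos ψ * s = h 1 - c * Real.sin ψ := by
        rw [hs', hc]; linear_combination h 1 * hsc
      rw [← hsin, hc] at this
      linear_combination this
    ext i
    fin_cases i
    · simpa [unitVec, circleAngle, ← hs, ← hα] using h0
    · simpa [unitVec, circleAngle, ← hs, ← hα] using h1

/-- A point of the circle determines its direction from `h` modulo `2π`, and equivariance under full
turns removes this ambiguity, giving injectivity. A continuous injective function on the line is
strictly monotone or antitone, and equivariance excludes the latter. -/
lemma strictMono_circleAngle {h : Plane} {κ : ℝ} (hκ : ‖h‖ < κ) :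
    StrictMono (circleAngle h κ) := by
  have hinj : Function.Injective (circleAngle h κ) := by
    intro a b hab
    obtain ⟨s, hs, hs'⟩ := exists_circleAngle_eq hκ a
    obtain ⟨t, ht, ht'⟩ := exists_circleAngle_eq hκ b
    rw [hab, ht'] at hs'
    obtain ⟨-, k, hk⟩ := exists_int_of_smul_unitVec_eq ht hs (add_left_cancel hs')
    rw [hk, circleAngle_add_int_mul_two_pi] at hab
    linarith
  refine ((continuous_circleAngle h κ).strictMono_of_inj hinj).resolve_right fun hanti => ?_
  have h1 := circleAngle_add_int_mul_two_pi h κ 0 1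
  have h2 := hanti (show (0 : ℝ) < 0 + ((1 : ℤ) : ℝ) * (2 * Real.pi) by
    simp [Real.pi_pos])
  rw [h1] at h2
  push_cast at h2
  linarith [Real.pi_pos]

/-- The arcsine shifts an angle by at most `π / 2`, so the intermediate value theorem on `[θ - π, θ
+ π]` suffices, whatever `h` and `κ` are. -/
lemma exists_eq_circleAngle (h : Plane) (κ θ : ℝ) : ∃ ψ, circleAngle h κ ψ = θ := by
  have hc := (continuous_circleAngle h κ).continuousOn (s := Set.Icc (θ - Real.pi) (θ + Real.pi))
  have hle : θ - Real.pi ≤ θ + Real.pi := by linarith [Real.pi_pos]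
  obtain ⟨ψ, -, hψ⟩ := intermediate_value_Icc hle hc (show θ ∈ Set.Icc _ _ by
    have h1 := Real.arcsin_le_pi_div_two (inner ℝ (normalVec (θ - Real.pi)) h / κ)
    have h2 := Real.neg_pi_div_two_le_arcsin (inner ℝ (normalVec (θ + Real.pi)) h / κ)
    have := Real.pi_pos
    constructor <;> unfold circleAngle <;> linarith)
  exact ⟨ψ, hψ⟩

/-- A circle about `p₀` meets a sector whose apex lies inside the circle in an arc. -/
lemma pointer_mem_sector_iff {p₀ p : Plane} {κ a b θ : ℝ} (hκ : ‖p - p₀‖ < κ)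
    (hb : b < a + 2 * Real.pi)
    (hθ : θ ∈ Set.Ico (circleAngle (p - p₀) κ a) (circleAngle (p - p₀) κ a + 2 * Real.pi)) :
    pointer p₀ θ κ ∈ sector p a b ↔ θ ≤ circleAngle (p - p₀) κ b := by
  have hκ0 : 0 < κ := (norm_nonneg _).trans_lt hκ
  have hmono := strictMono_circleAngle hκ
  -- Pass from the polar angle about `p₀` to the direction `ψ` seen from `p`. Monotonicity turns the
  -- claim into `ψ ≤ b` for `ψ` in `[a, a + 2π)`, where `b < a + 2π` leaves no room for another lift
  -- of the angle.
  obtain ⟨ψ, rfl⟩ := exists_eq_circleAngle (p - p₀) κ θ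
  obtain ⟨l, hl, hl'⟩ := exists_circleAngle_eq hκ ψ
  rw [pointer_eq, hl', hmono.le_iff_le]
  have haψ : a ≤ ψ := hmono.le_iff_le.1 hθ.1
  constructor
  · rintro ⟨t, ht, χ, ⟨hχa, hχb⟩, hq⟩
    rw [pointer_eq] at hq
    have hq' : l • unitVec ψ = t • unitVec χ := by
      have : p₀ + (p - p₀ + l • unitVec ψ) = p + l • unitVec ψ := by abel
      rw [this] at hq
      exact add_left_cancel hq
    rcases ht.eq_or_lt with rfl | ht
    · rw [zero_smul] at hq'
      have := congrArg norm hq'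
      rw [norm_smul, norm_unitVec, mul_one, norm_zero, norm_eq_zero] at this
      exact absurd this hl.ne'
    obtain ⟨-, k, hk⟩ := exists_int_of_smul_unitVec_eq hl ht hq'
    have hψ2 : ψ < a + 2 * Real.pi := by
      have := circleAngle_add_int_mul_two_pi (p - p₀) κ a 1
      have h2 := hθ.2
      simp only [Int.cast_one, one_mul] at this
      rw [← this] at h2
      exact hmono.lt_iff_lt.1 h2
    have hpi := Real.pi_pos
    have hk1 : (k : ℝ) < 1 := by
      by_contra hcon
      push Not at hcon
      nlinarith
    have hk2 : (-1 : ℝ) < k := by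
      by_contra hcon
      push Not at hcon
      nlinarith
    have : k = 0 := by
      have h1 : k < 1 := by exact_mod_cast hk1
      have h2 : -1 < k := by exact_mod_cast hk2
      omega
    subst this
    simp at hk
    linarith
  · intro h
    refine ⟨l, hl.le, ψ, ⟨haψ, h⟩, ?_⟩
    rw [pointer_eq]
    abel

/-! ### Polar integration over sectors. -/

lemma measurableSet_sector (p : Plane) (a b : ℝ) : MeasurableSet (sector p a b) := by
  have : sector p a b =
      ⋃ n : ℕ, (fun z : ℝ × ℝ => pointer p z.2 z.1) '' (Set.Icc 0 (n : ℝ) ×ˢ Set.Icc a b) := by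
    ext q
    simp only [Set.mem_iUnion, Set.mem_image, Set.mem_prod, sector, Set.mem_ofPred_eq]
    constructor
    · rintro ⟨κ, hκ, θ, hθ, rfl⟩
      obtain ⟨n, hn⟩ := exists_nat_ge κ
      exact ⟨n, (κ, θ), ⟨⟨hκ, hn⟩, hθ⟩, rfl⟩
    · rintro ⟨n, ⟨κ, θ⟩, ⟨⟨hκ, -⟩, hθ⟩, rfl⟩
      exact ⟨κ, hκ, θ, hθ, rfl⟩
  rw [this]
  exact MeasurableSet.iUnion fun n =>
    ((isCompact_Icc.prod isCompact_Icc).image (continuous_pointer p)).isClosed.measurableSet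

lemma stronglyMeasurable_comp_pointer {E : Type*} [NormedAddCommGroup E] {g : Plane → E} (hg : StronglyMeasurable g) (p : Plane) :
    StronglyMeasurable fun z : ℝ × ℝ => g (pointer p z.2 z.1) :=
  hg.comp_measurable (continuous_pointer p).measurable

lemma stronglyMeasurable_comp_pointer_angle {E : Type*} [NormedAddCommGroup E] {g : Plane → E} (hg : StronglyMeasurable g)
    (p : Plane) (κ : ℝ) : StronglyMeasurable fun θ : ℝ => g (pointer p θ κ) :=
  (stronglyMeasurable_comp_pointer hg p).comp_measurable
    (measurable_const.prodMk measurable_id : Measurable fun θ : ℝ => (κ, θ))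

lemma intervalIntegrable_comp_pointer {E : Type*} [NormedAddCommGroup E] {g : Plane → E} (hg : StronglyMeasurable g) {B : ℝ}
    (hB : ∀ q, ‖g q‖ ≤ B) (p : Plane) (κ a b : ℝ) :
    IntervalIntegrable (fun θ => g (pointer p θ κ)) volume a b := by
  have h : ∀ s : Set ℝ, volume s ≠ ⊤ → IntegrableOn (fun θ => g (pointer p θ κ)) s := fun s hs =>
    Measure.integrableOn_of_bounded hs
      (stronglyMeasurable_comp_pointer_angle hg p κ).aestronglyMeasurable
      (M := B) (Eventually.of_forall fun _ => hB _)
  exact ⟨h _ (by simp), h _ (by simp)⟩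

variable {E : Type*} [NormedAddCommGroup E] [NormedSpace ℝ E]

/-- Integration in polar coordinates about `p`. -/
lemma integral_polar {g : Plane → E} (hg : StronglyMeasurable g) {B : ℝ}
    (hB : ∀ q, ‖g q‖ ≤ B) {p : Plane} {R : ℝ} (hR : ∀ q, R ≤ dist q p → g q = 0) :
    ∫ q, g q = ∫ κ in Set.Ioo 0 R, κ • ∫ θ in (-Real.pi)..Real.pi, g (pointer p θ κ) := by
  have h1 : ∫ q, g q = ∫ z : ℂ, g (p + Complex.orthonormalBasisOneI.repr z) := by
    rw [← integral_add_left_eq_self g p]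
    exact ((Complex.orthonormalBasisOneI.repr.measurePreserving).integral_comp
      Complex.orthonormalBasisOneI.repr.toHomeomorph.measurableEmbedding
      (fun q => g (p + q))).symm
  rw [h1, ← Complex.integral_comp_polarCoord_symm]
  have h2 : ∀ z : ℝ × ℝ, p + Complex.orthonormalBasisOneI.repr (Complex.polarCoord.symm z)
      = pointer p z.2 z.1 := by
    intro z
    rw [pointer_eq, Complex.polarCoord_symm_apply]
    congr 1
    ext i
    fin_cases i <;> simp [unitVec, Complex.orthonormalBasisOneI_repr_apply,
      Complex.cos_ofReal_re, Complex.sin_ofReal_re]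
  simp only [h2]
  have h3 : ∫ z in polarCoord.target, z.1 • g (pointer p z.2 z.1)
      = ∫ z in Set.Ioo 0 R ×ˢ Set.Ioo (-Real.pi) Real.pi, z.1 • g (pointer p z.2 z.1) := by
    refine setIntegral_eq_of_subset_of_forall_sdiff_eq_zero ?_ ?_ ?_
    · exact measurableSet_Ioi.prod measurableSet_Ioo
    · exact Set.prod_mono Set.Ioo_subset_Ioi_self subset_rfl
    · rintro ⟨κ, θ⟩ ⟨hz, hz'⟩
      have hz1 : 0 < κ ∧ θ ∈ Set.Ioo (-Real.pi) Real.pi := hz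
      have : R ≤ κ := by
        by_contra hcon
        exact hz' ⟨⟨hz1.1, lt_of_not_ge hcon⟩, hz1.2⟩
      simp only
      rw [hR, smul_zero]
      rwa [dist_pointer p θ hz1.1.le]
  rw [h3, Measure.volume_eq_prod, setIntegral_prod]
  · refine setIntegral_congr_fun measurableSet_Ioo fun κ _ => ?_
    simp only
    rw [integral_smul, intervalIntegral.integral_of_le (by linarith [Real.pi_pos]),
      integral_Ioc_eq_integral_Ioo]
  · refine Measure.integrableOn_of_bounded (M := R * B) ?_ ?_ ?_
    · rw [Measure.prod_prod]
      exact ENNReal.mul_ne_top (by simp) (by simp)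
    · exact (measurable_fst.stronglyMeasurable.smul
        (stronglyMeasurable_comp_pointer hg p)).aestronglyMeasurable
    · refine (ae_restrict_iff' (measurableSet_Ioo.prod measurableSet_Ioo)).2
        (Eventually.of_forall ?_)
      rintro ⟨κ, θ⟩ ⟨hκ, -⟩
      have hκ' : 0 < κ ∧ κ < R := hκ
      rw [norm_smul, Real.norm_of_nonneg hκ'.1.le]
      exact mul_le_mul hκ'.2.le (hB _) (norm_nonneg _) (hκ'.1.trans hκ'.2).le

/-- The integral over the intersection of a sector with a circle that surrounds its apex. -/
lemma integral_circle_inter_sector {f : Plane → E} (hf : StronglyMeasurable f) {B : ℝ}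
    (hB : ∀ q, ‖f q‖ ≤ B) {p₀ p : Plane} {κ a b : ℝ} (hκ : ‖p - p₀‖ < κ) (hab : a ≤ b)
    (hb : b < a + 2 * Real.pi) :
    ∫ θ in (-Real.pi)..Real.pi, (sector p a b).indicator f (pointer p₀ θ κ)
      = ∫ θ in (circleAngle (p - p₀) κ a)..(circleAngle (p - p₀) κ b), f (pointer p₀ θ κ) := by
  set g := (sector p a b).indicator f with hg
  have hgm : StronglyMeasurable g := hf.indicator (measurableSet_sector p a b)
  have hgB : ∀ q, ‖g q‖ ≤ B := fun q => (norm_indicator_le_norm_self f q).trans (hB q)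
  have hper : Function.Periodic (fun θ => g (pointer p₀ θ κ)) (2 * Real.pi) := by
    intro θ
    simp only [pointer_eq, unitVec_add_two_pi]
  have hmono := strictMono_circleAngle hκ
  set A := circleAngle (p - p₀) κ a
  have hAB : A ≤ circleAngle (p - p₀) κ b := hmono.monotone hab
  have hBA : circleAngle (p - p₀) κ b < A + 2 * Real.pi := by
    have := circleAngle_add_int_mul_two_pi (p - p₀) κ a 1
    simp only [Int.cast_one, one_mul] at this
    rw [← this]
    exact hmono hb
  set C := circleAngle (p - p₀) κ b with hC
  -- Periodicity moves the full turn to `[A, A + 2π]`, where the sector occupies exactly `[A, C]`.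
  have h1 := hper.intervalIntegral_add_eq (-Real.pi) A
  rw [show -Real.pi + 2 * Real.pi = Real.pi by ring] at h1
  rw [h1, ← intervalIntegral.integral_add_adjacent_intervals
    (intervalIntegrable_comp_pointer hgm hgB p₀ κ A C)
    (intervalIntegrable_comp_pointer hgm hgB p₀ κ C _)]
  have h2 : ∫ θ in C..(A + 2 * Real.pi), g (pointer p₀ θ κ) = 0 := by
    rw [intervalIntegral.integral_of_le hBA.le, integral_Ioc_eq_integral_Ioo]
    refine setIntegral_eq_zero_of_forall_eq_zero fun θ hθ => ?_
    refine Set.indicator_of_notMem (fun hmem => ?_) _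
    have := (pointer_mem_sector_iff hκ hb ⟨hAB.trans hθ.1.le, hθ.2⟩).1 hmem
    exact absurd hθ.1 (not_lt.2 this)
  rw [h2, add_zero]
  refine intervalIntegral.integral_congr fun θ hθ => ?_
  rw [Set.uIcc_of_le hAB] at hθ
  exact Set.indicator_of_mem
    ((pointer_mem_sector_iff hκ hb ⟨hθ.1, hθ.2.trans_lt hBA⟩).2 hθ.2) _

end

/-! ### Differentiability of sector integrals. -/

noncomputable section

/-- This is Jordan's inequality `2 x / π ≤ sin x` for the inverse function. It stays linear up to
`|u| = 1`, where the derivative of arcsine blows up. -/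
lemma abs_arcsin_le {u : ℝ} (hu : |u| ≤ 1) : |Real.arcsin u| ≤ Real.pi / 2 * |u| := by
  have key : ∀ v : ℝ, 0 ≤ v → v ≤ 1 → Real.arcsin v ≤ Real.pi / 2 * v := by
    intro v hv0 hv1
    have h := Real.mul_le_sin (Real.arcsin_nonneg.2 hv0) (Real.arcsin_le_pi_div_two v)
    rw [Real.sin_arcsin (by linarith) hv1] at h
    have hpi := Real.pi_pos
    rw [div_mul_eq_mul_div, div_le_iff₀ hpi] at h
    linarith
  rcases le_total 0 u with h | h
  · rw [abs_of_nonneg h] at hu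
    rw [abs_of_nonneg (Real.arcsin_nonneg.2 h), abs_of_nonneg h]
    exact key u h hu
  · rw [abs_of_nonpos h] at hu
    rw [abs_of_nonpos (Real.arcsin_nonpos.2 h), abs_of_nonpos h, ← Real.arcsin_neg]
    exact key _ (by linarith) hu

/-- The normal velocity, at distance `κ` from the reference point, of a pointer of angle `θ` whose
reference point and angle move with given velocities. -/
def barForm (θ κ : ℝ) : Plane × ℝ →L[ℝ] ℝ :=
  κ • ContinuousLinearMap.snd ℝ Plane ℝ
    + (innerSL ℝ (normalVec θ)).comp (ContinuousLinearMap.fst ℝ Plane ℝ)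

lemma barForm_apply (θ κ : ℝ) (z : Plane × ℝ) :
    barForm θ κ z = κ * z.2 + inner ℝ (normalVec θ) z.1 := by simp [barForm]

lemma norm_barForm_le (θ : ℝ) {κ : ℝ} (hκ : 0 ≤ κ) : ‖barForm θ κ‖ ≤ κ + 1 := by
  refine ContinuousLinearMap.opNorm_le_bound _ (by linarith) fun z => ?_
  rw [barForm_apply]
  have h1 := abs_inner_normalVec_le z.1 θ
  have h2 : ‖z.1‖ ≤ ‖z‖ := norm_fst_le z
  have h3 : |z.2| ≤ ‖z‖ := norm_snd_le z
  calc ‖κ * z.2 + inner ℝ (normalVec θ) z.1‖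
      ≤ |κ * z.2| + |inner ℝ (normalVec θ) z.1| := abs_add_le _ _
    _ ≤ κ * ‖z‖ + 1 * ‖z‖ := by
        rw [abs_mul, abs_of_nonneg hκ]
        nlinarith
    _ = (κ + 1) * ‖z‖ := by ring

lemma continuous_barForm (θ : ℝ) : Continuous (barForm θ) := by
  unfold barForm
  fun_prop

lemma hasFDerivAt_circleAngle (p₀ : Plane) {κ : ℝ} (hκ : 0 < κ) (θ : ℝ) :
    HasFDerivAt (fun z : Plane × ℝ => circleAngle (z.1 - p₀) κ z.2) (κ⁻¹ • barForm θ κ)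
      (p₀, θ) := by
  have h1 : HasFDerivAt (fun z : Plane × ℝ => z.1 - p₀) (ContinuousLinearMap.fst ℝ Plane ℝ)
      (p₀, θ) := hasFDerivAt_fst.sub_const p₀
  have hc : ∀ i : Fin 2, HasFDerivAt (fun z : Plane × ℝ => (z.1 - p₀) i)
      ((EuclideanSpace.proj i : Plane →L[ℝ] ℝ).comp (ContinuousLinearMap.fst ℝ Plane ℝ))
      (p₀, θ) := fun i =>
    (EuclideanSpace.proj i : Plane →L[ℝ] ℝ).hasFDerivAt.comp (p₀, θ) h1
  have h2 : HasFDerivAt (fun z : Plane × ℝ => z.2) (ContinuousLinearMap.snd ℝ Plane ℝ)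
      (p₀, θ) := hasFDerivAt_snd
  have h3 := ((h2.sin.neg.mul (hc 0)).add (h2.cos.mul (hc 1))).mul_const κ⁻¹
  have h4 : HasDerivAt Real.arcsin 1 0 := by
    simpa using Real.hasDerivAt_arcsin (x := 0) (by norm_num) (by norm_num)
  have h5 := h2.add (HasDerivAt.comp_hasFDerivAt_of_eq (p₀, θ) h4 h3 (by simp))
  refine (h5.congr_fderiv ?_).congr_of_eventuallyEq (Eventually.of_forall fun z => ?_)
  · refine ContinuousLinearMap.ext fun z => ?_
    simp [barForm_apply, inner_normalVec]
    field_simp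
  · simp [circleAngle, inner_normalVec, div_eq_mul_inv]

variable {E : Type*} [NormedAddCommGroup E] [NormedSpace ℝ E]

/-- The derivative of the `f`-flux through the bar with reference point `p` and angle `θ`, as a
linear function of the velocities of the reference point and of the angle. -/
def barDeriv (f : Plane → E) (R : ℝ) (p : Plane) (θ : ℝ) : Plane × ℝ →L[ℝ] E :=
  ∫ κ in Set.Ioo 0 R, (barForm θ κ).smulRight (f (pointer p θ κ))

lemma integrableOn_barForm_smulRight {f : Plane → E} (hf : StronglyMeasurable f) {B : ℝ}
    (hB : ∀ q, ‖f q‖ ≤ B) (R : ℝ) (p : Plane) (θ : ℝ) :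
    IntegrableOn (fun κ => (barForm θ κ).smulRight (f (pointer p θ κ))) (Set.Ioo 0 R) := by
  refine Measure.integrableOn_of_bounded (M := (R + 1) * B) (by simp) ?_ ?_
  · exact (ContinuousLinearMap.smulRightL ℝ (Plane × ℝ) E).aestronglyMeasurable_comp₂
      (continuous_barForm θ).aestronglyMeasurable
      ((stronglyMeasurable_comp_pointer hf p).comp_measurable
        (measurable_id.prodMk measurable_const : Measurable fun κ : ℝ => (κ, θ))
        ).aestronglyMeasurable
  · refine (ae_restrict_iff' measurableSet_Ioo).2 (Eventually.of_forall fun κ hκ => ?_)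
    rw [ContinuousLinearMap.norm_smulRight_apply]
    have := norm_barForm_le θ hκ.1.le
    exact mul_le_mul (by linarith [hκ.2]) (hB _) (norm_nonneg _) (by linarith [hκ.1, hκ.2])

lemma norm_barDeriv_le {f : Plane → E} {B : ℝ}
    (hB : ∀ q, ‖f q‖ ≤ B) {R : ℝ} (hR : 0 ≤ R) (p : Plane) (θ : ℝ) :
    ‖barDeriv f R p θ‖ ≤ (R + 1) * B * R := by
  have h := norm_setIntegral_le_of_norm_le_const (μ := volume) (s := Set.Ioo 0 R)
    (C := (R + 1) * B) (f := fun κ => (barForm θ κ).smulRight (f (pointer p θ κ)))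
    (by simp) (fun κ hκ => by
      rw [ContinuousLinearMap.norm_smulRight_apply]
      have := norm_barForm_le θ hκ.1.le
      exact mul_le_mul (by linarith [hκ.2]) (hB _) (norm_nonneg _) (by linarith [hκ.1, hκ.2]))
  simpa [barDeriv, hR] using h

lemma barDeriv_angle [CompleteSpace E] {f : Plane → E} (hf : StronglyMeasurable f) {B : ℝ}
    (hB : ∀ q, ‖f q‖ ≤ B) (R : ℝ) (p : Plane) (θ : ℝ) :
    barDeriv f R p θ (0, 1) = ∫ κ in Set.Ioo 0 R, κ • f (pointer p θ κ) := by
  rw [barDeriv, ContinuousLinearMap.integral_apply (integrableOn_barForm_smulRight hf hB R p θ)]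
  simp [barForm_apply]

/-- The integral of `f` over the sector with apex `x.1` between the angles `x.2.1`, `x.2.2`. -/
def sectorIntegral (f : Plane → E) (x : Plane × ℝ × ℝ) : E :=
  ∫ q in sector x.1 x.2.1 x.2.2, f q

/-- The data of the first bar of a sector. -/
def firstBar : Plane × ℝ × ℝ →L[ℝ] Plane × ℝ :=
  (ContinuousLinearMap.fst ℝ Plane (ℝ × ℝ)).prod
    ((ContinuousLinearMap.fst ℝ ℝ ℝ).comp (ContinuousLinearMap.snd ℝ Plane (ℝ × ℝ)))

/-- The data of the last bar of a sector. -/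
def lastBar : Plane × ℝ × ℝ →L[ℝ] Plane × ℝ :=
  (ContinuousLinearMap.fst ℝ Plane (ℝ × ℝ)).prod
    ((ContinuousLinearMap.snd ℝ ℝ ℝ).comp (ContinuousLinearMap.snd ℝ Plane (ℝ × ℝ)))

/-- The derivative of `sectorIntegral f` at `x`. -/
def sectorDeriv (f : Plane → E) (R : ℝ) (x : Plane × ℝ × ℝ) : Plane × ℝ × ℝ →L[ℝ] E :=
  (barDeriv f R x.1 x.2.2).comp lastBar - (barDeriv f R x.1 x.2.1).comp firstBar

lemma sectorDeriv_apply (f : Plane → E) (R : ℝ) (x v : Plane × ℝ × ℝ) :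
    sectorDeriv f R x v
      = barDeriv f R x.1 x.2.2 (v.1, v.2.2) - barDeriv f R x.1 x.2.1 (v.1, v.2.1) := rfl

lemma norm_sectorDeriv_apply_le {f : Plane → E} {B : ℝ}
    (hB : ∀ q, ‖f q‖ ≤ B) {R : ℝ} (hR : 0 ≤ R) (x v : Plane × ℝ × ℝ) :
    ‖sectorDeriv f R x v‖ ≤ 2 * ((R + 1) * B * R) * ‖v‖ := by
  rw [sectorDeriv_apply]
  have hB0 : 0 ≤ B := (norm_nonneg _).trans (hB 0)
  have h : ∀ θ (w : Plane × ℝ), ‖w‖ ≤ ‖v‖ → ‖barDeriv f R x.1 θ w‖ ≤ (R + 1) * B * R * ‖v‖ :=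
    fun θ w hw => ((barDeriv f R x.1 θ).le_of_opNorm_le (norm_barDeriv_le hB hR _ _) w).trans
      (mul_le_mul_of_nonneg_left hw (by positivity))
  have h1 : ‖v.1‖ ≤ ‖v‖ := norm_fst_le v
  have h2 : ‖v.2‖ ≤ ‖v‖ := norm_snd_le v
  have h3 := h x.2.2 (v.1, v.2.2) (max_le h1 ((norm_snd_le v.2).trans h2))
  have h4 := h x.2.1 (v.1, v.2.1) (max_le h1 ((norm_fst_le v.2).trans h2))
  linarith [norm_sub_le (barDeriv f R x.1 x.2.2 (v.1, v.2.2))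
    (barDeriv f R x.1 x.2.1 (v.1, v.2.1))]

/-- The integral of `f` over the intersection of a sector with the circle of radius `κ` about
`p₀`, with respect to polar coordinates. -/
def arcIntegral (f : Plane → E) (p₀ : Plane) (x : Plane × ℝ × ℝ) (κ : ℝ) : E :=
  κ • ∫ θ in (-Real.pi)..Real.pi, (sector x.1 x.2.1 x.2.2).indicator f (pointer p₀ θ κ)

lemma sectorIntegral_eq {f : Plane → E} (hf : StronglyMeasurable f) {B : ℝ}
    (hB : ∀ q, ‖f q‖ ≤ B) {p₀ : Plane} {R : ℝ} (hR : ∀ q, R ≤ dist q p₀ → f q = 0)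
    (x : Plane × ℝ × ℝ) :
    sectorIntegral f x = ∫ κ in Set.Ioo 0 R, arcIntegral f p₀ x κ := by
  have hS := measurableSet_sector x.1 x.2.1 x.2.2
  rw [sectorIntegral, ← integral_indicator hS]
  refine integral_polar (hf.indicator hS)
    (fun q => (norm_indicator_le_norm_self f q).trans (hB q)) fun q hq => ?_
  by_cases h : q ∈ sector x.1 x.2.1 x.2.2
  · rw [Set.indicator_of_mem h, hR q hq]
  · exact Set.indicator_of_notMem h _

lemma arcIntegral_eq {f : Plane → E} (hf : StronglyMeasurable f) {B : ℝ}
    (hB : ∀ q, ‖f q‖ ≤ B) {p₀ : Plane} {κ : ℝ} {x : Plane × ℝ × ℝ} (hκ : ‖x.1 - p₀‖ < κ)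
    (hx : x.2.1 ≤ x.2.2) (hx' : x.2.2 < x.2.1 + 2 * Real.pi) :
    arcIntegral f p₀ x κ =
      κ • ∫ θ in (circleAngle (x.1 - p₀) κ x.2.1)..(circleAngle (x.1 - p₀) κ x.2.2),
        f (pointer p₀ θ κ) := by
  rw [arcIntegral, integral_circle_inter_sector hf hB hκ hx hx']

lemma norm_arcIntegral_le {f : Plane → E} {B : ℝ}
    (hB : ∀ q, ‖f q‖ ≤ B) (p₀ : Plane) {κ : ℝ} (hκ : 0 ≤ κ) (x : Plane × ℝ × ℝ) :
    ‖arcIntegral f p₀ x κ‖ ≤ κ * (B * (2 * Real.pi)) := by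
  rw [arcIntegral, norm_smul, Real.norm_of_nonneg hκ]
  refine mul_le_mul_of_nonneg_left ?_ hκ
  have := intervalIntegral.norm_integral_le_of_norm_le_const (a := -Real.pi) (b := Real.pi)
    (C := B) (f := fun θ => (sector x.1 x.2.1 x.2.2).indicator f (pointer p₀ θ κ))
    fun θ _ => (norm_indicator_le_norm_self f _).trans (hB _)
  rwa [show Real.pi - -Real.pi = 2 * Real.pi by ring,
    abs_of_pos (by linarith [Real.pi_pos])] at this

lemma aestronglyMeasurable_arcIntegral {f : Plane → E} (hf : StronglyMeasurable f)
    (p₀ : Plane) (x : Plane × ℝ × ℝ) (μ : Measure ℝ) :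
    AEStronglyMeasurable (arcIntegral f p₀ x) μ := by
  unfold arcIntegral
  simp only [intervalIntegral.integral_of_le (by linarith [Real.pi_pos] : -Real.pi ≤ Real.pi)]
  exact (measurable_id.stronglyMeasurable.smul (StronglyMeasurable.integral_prod_right
    (f := fun κ θ => (sector x.1 x.2.1 x.2.2).indicator f (pointer p₀ θ κ))
    (stronglyMeasurable_comp_pointer (hf.indicator (measurableSet_sector _ _ _)) p₀)
    )).aestronglyMeasurable

/-- This is the domination, uniform in small `κ`, for differentiating under the integral. If the
circle surrounds the moved apex, each end of the arc moves by an angle of order `(1 + 1/κ) ‖x -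
x₀‖`, and the Jacobian `κ` absorbs the singularity. Otherwise `κ ≤ ‖x - x₀‖`, and the trivial bound
`2πBκ` on each integral is enough; this is the source of `4π`. -/
lemma norm_arcIntegral_sub_le {f : Plane → E} (hf : StronglyMeasurable f) {B : ℝ}
    (hB : ∀ q, ‖f q‖ ≤ B) {x₀ x : Plane × ℝ × ℝ} {κ : ℝ} (hκ : 0 < κ)
    (hx₀ : x₀.2.1 ≤ x₀.2.2) (hx₀' : x₀.2.2 < x₀.2.1 + 2 * Real.pi)
    (hx : x.2.1 ≤ x.2.2) (hx' : x.2.2 < x.2.1 + 2 * Real.pi) :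
    ‖arcIntegral f x₀.1 x κ - arcIntegral f x₀.1 x₀ κ‖
      ≤ B * (2 * κ + 4 * Real.pi) * ‖x - x₀‖ := by
  have hpi := Real.pi_pos
  have hB0 : 0 ≤ B := (norm_nonneg _).trans (hB 0)
  have hn1 : ‖x.1 - x₀.1‖ ≤ ‖x - x₀‖ := norm_fst_le (x - x₀)
  have hn2 : ‖x.2 - x₀.2‖ ≤ ‖x - x₀‖ := norm_snd_le (x - x₀)
  have hn21 : |x.2.1 - x₀.2.1| ≤ ‖x - x₀‖ := (norm_fst_le (x.2 - x₀.2)).trans hn2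
  have hn22 : |x.2.2 - x₀.2.2| ≤ ‖x - x₀‖ := (norm_snd_le (x.2 - x₀.2)).trans hn2
  rcases lt_or_ge ‖x.1 - x₀.1‖ κ with h | h
  · have hint := intervalIntegrable_comp_pointer hf hB x₀.1 κ
    rw [arcIntegral_eq hf hB h hx hx',
      arcIntegral_eq hf hB (by simpa using hκ) hx₀ hx₀', sub_self, circleAngle_zero,
      circleAngle_zero, ← smul_sub, intervalIntegral.integral_interval_sub_interval_comm
        (hint _ _) (hint _ _) (hint _ _), norm_smul, Real.norm_of_nonneg hκ.le]
    have key : ∀ ψ₀ ψ : ℝ, |ψ - ψ₀| ≤ ‖x - x₀‖ →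
        κ * |circleAngle (x.1 - x₀.1) κ ψ - ψ₀| ≤ (κ + Real.pi / 2) * ‖x - x₀‖ := by
      intro ψ₀ ψ hψ
      set s : ℝ := inner ℝ (normalVec ψ) (x.1 - x₀.1) with hs
      have hsle : |s| ≤ ‖x.1 - x₀.1‖ := abs_inner_normalVec_le _ _
      have hs1 : |s / κ| = |s| / κ := by rw [abs_div, abs_of_pos hκ]
      have ha := abs_arcsin_le (u := s / κ) (by
        rw [hs1, div_le_one hκ]; linarith)
      rw [hs1] at ha
      have htri : |circleAngle (x.1 - x₀.1) κ ψ - ψ₀| ≤ |ψ - ψ₀| + |Real.arcsin (s / κ)| := by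
        rw [circleAngle, ← hs, add_sub_right_comm]
        exact abs_add_le _ _
      calc κ * |circleAngle (x.1 - x₀.1) κ ψ - ψ₀|
          ≤ κ * (‖x - x₀‖ + Real.pi / 2 * (|s| / κ)) := by gcongr; linarith
        _ = κ * ‖x - x₀‖ + Real.pi / 2 * |s| := by field_simp
        _ ≤ κ * ‖x - x₀‖ + Real.pi / 2 * ‖x - x₀‖ := by gcongr; exact hsle.trans hn1
        _ = _ := by ring
    have hI : ∀ u v : ℝ, ‖∫ θ in u..v, f (pointer x₀.1 θ κ)‖ ≤ B * |v - u| := fun u v =>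
      intervalIntegral.norm_integral_le_of_norm_le_const fun θ _ => hB _
    have h1 := key _ _ hn21
    have h2 := key _ _ hn22
    set A := circleAngle (x.1 - x₀.1) κ x.2.1
    set C := circleAngle (x.1 - x₀.1) κ x.2.2
    have hA := hI A x₀.2.1
    have hC := hI C x₀.2.2
    rw [abs_sub_comm] at hA hC
    calc κ * ‖(∫ θ in A..x₀.2.1, f (pointer x₀.1 θ κ)) - ∫ θ in C..x₀.2.2, f (pointer x₀.1 θ κ)‖
        ≤ κ * (B * |A - x₀.2.1| + B * |C - x₀.2.2|) := by
          gcongr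
          exact (norm_sub_le _ _).trans (add_le_add hA hC)
      _ = B * (κ * |A - x₀.2.1| + κ * |C - x₀.2.2|) := by ring
      _ ≤ B * ((κ + Real.pi / 2) * ‖x - x₀‖ + (κ + Real.pi / 2) * ‖x - x₀‖) := by gcongr
      _ ≤ B * (2 * κ + 4 * Real.pi) * ‖x - x₀‖ := by
          have : 0 ≤ B * (3 * Real.pi * ‖x - x₀‖) := by positivity
          nlinarith
  · have h1 := norm_arcIntegral_le hB x₀.1 hκ.le x
    have h2 := norm_arcIntegral_le hB x₀.1 hκ.le x₀
    calc _ ≤ κ * (B * (2 * Real.pi)) + κ * (B * (2 * Real.pi)) :=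
          (norm_sub_le _ _).trans (add_le_add h1 h2)
      _ = B * (4 * Real.pi) * κ := by ring
      _ ≤ B * (4 * Real.pi) * ‖x - x₀‖ := by gcongr; exact h.trans hn1
      _ ≤ _ := by gcongr; linarith

/-- For fixed `κ > 0` a nearby apex stays inside the circle, so the fundamental theorem of calculus
with moving endpoints applies. The factor `κ` cancels the `κ⁻¹` in the derivative of the endpoints.
-/
lemma hasFDerivAt_arcIntegral [CompleteSpace E] {f : Plane → E} (hf : StronglyMeasurable f)
    {B : ℝ} (hB : ∀ q, ‖f q‖ ≤ B) {x₀ : Plane × ℝ × ℝ} {κ : ℝ} (hκ : 0 < κ)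
    (hx₀ : x₀.2.1 < x₀.2.2) (hx₀' : x₀.2.2 < x₀.2.1 + 2 * Real.pi)
    (hca : ContinuousAt f (pointer x₀.1 x₀.2.1 κ)) (hcb : ContinuousAt f (pointer x₀.1 x₀.2.2 κ)) :
    HasFDerivAt (fun x => arcIntegral f x₀.1 x κ)
      (((barForm x₀.2.2 κ).smulRight (f (pointer x₀.1 x₀.2.2 κ))).comp lastBar
        - ((barForm x₀.2.1 κ).smulRight (f (pointer x₀.1 x₀.2.1 κ))).comp firstBar) x₀ := by
  have hev : ∀ᶠ x : Plane × ℝ × ℝ in 𝓝 x₀, arcIntegral f x₀.1 x κ =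
      κ • ∫ θ in (circleAngle (x.1 - x₀.1) κ x.2.1)..(circleAngle (x.1 - x₀.1) κ x.2.2),
        f (pointer x₀.1 θ κ) := by
    have h1 : ∀ᶠ x : Plane × ℝ × ℝ in 𝓝 x₀, ‖x.1 - x₀.1‖ < κ :=
      (Continuous.tendsto (by fun_prop) x₀).eventually_lt_const (by simpa using hκ)
    have h2 : ∀ᶠ x : Plane × ℝ × ℝ in 𝓝 x₀, x.2.1 < x.2.2 :=
      (isOpen_lt (by fun_prop) (by fun_prop)).mem_nhds hx₀
    have h3 : ∀ᶠ x : Plane × ℝ × ℝ in 𝓝 x₀, x.2.2 < x.2.1 + 2 * Real.pi :=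
      (isOpen_lt (by fun_prop) (by fun_prop)).mem_nhds hx₀'
    filter_upwards [h1, h2, h3] with x h1 h2 h3 using arcIntegral_eq hf hB h1 h2.le h3
  refine HasFDerivAt.congr_of_eventuallyEq ?_ hev
  have hcont : ∀ ψ, Tendsto (fun θ => pointer x₀.1 θ κ) (𝓝 ψ) (𝓝 (pointer x₀.1 ψ κ)) := fun ψ =>
    (continuous_pointer x₀.1 |>.comp (continuous_const.prodMk continuous_id :
      Continuous fun θ : ℝ => (κ, θ))).tendsto ψ
  have hmeas : ∀ ψ, StronglyMeasurableAtFilter (fun θ => f (pointer x₀.1 θ κ)) (𝓝 ψ) := fun ψ =>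
    (stronglyMeasurable_comp_pointer_angle hf x₀.1 κ).stronglyMeasurableAtFilter
  have h1 := intervalIntegral.integral_hasFDerivAt
    (intervalIntegrable_comp_pointer hf hB x₀.1 κ x₀.2.1 x₀.2.2) (hmeas _) (hmeas _)
    (ContinuousAt.comp hca (hcont _)) (ContinuousAt.comp hcb (hcont _))
  have ha : HasFDerivAt (fun x : Plane × ℝ × ℝ => circleAngle (x.1 - x₀.1) κ x.2.1)
      ((κ⁻¹ • barForm x₀.2.1 κ).comp firstBar) x₀ :=
    HasFDerivAt.comp (f := firstBar) x₀ (hasFDerivAt_circleAngle x₀.1 hκ x₀.2.1)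
      firstBar.hasFDerivAt
  have hb : HasFDerivAt (fun x : Plane × ℝ × ℝ => circleAngle (x.1 - x₀.1) κ x.2.2)
      ((κ⁻¹ • barForm x₀.2.2 κ).comp lastBar) x₀ :=
    HasFDerivAt.comp (f := lastBar) x₀ (hasFDerivAt_circleAngle x₀.1 hκ x₀.2.2)
      lastBar.hasFDerivAt
  have hpt : (x₀.2.1, x₀.2.2) =
      (circleAngle (x₀.1 - x₀.1) κ x₀.2.1, circleAngle (x₀.1 - x₀.1) κ x₀.2.2) := by
    simp [circleAngle_zero]
  rw [hpt] at h1
  have h2 := (HasFDerivAt.comp x₀ h1 (ha.prodMk hb)).const_smul κ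
  refine h2.congr_fderiv (ContinuousLinearMap.ext fun v => ?_)
  simp [smul_sub, smul_smul, hκ.ne']

/-- The integral over a sector is differentiable in the apex and in both angles wherever the
integrand is continuous almost everywhere along both bars. -/
theorem hasFDerivAt_sectorIntegral [CompleteSpace E] {f : Plane → E} (hf : StronglyMeasurable f)
    {B : ℝ} (hB : ∀ q, ‖f q‖ ≤ B) {x₀ : Plane × ℝ × ℝ} {R : ℝ}
    (hR : ∀ q, R ≤ dist q x₀.1 → f q = 0)
    (hx₀ : x₀.2.1 < x₀.2.2) (hx₀' : x₀.2.2 < x₀.2.1 + 2 * Real.pi)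
    (hca : ∀ᵐ κ ∂(volume.restrict (Set.Ioo 0 R)), ContinuousAt f (pointer x₀.1 x₀.2.1 κ))
    (hcb : ∀ᵐ κ ∂(volume.restrict (Set.Ioo 0 R)), ContinuousAt f (pointer x₀.1 x₀.2.2 κ)) :
    HasFDerivAt (sectorIntegral f) (sectorDeriv f R x₀) x₀ := by
  have hB0 : 0 ≤ B := (norm_nonneg _).trans (hB 0)
  have hpos : ∀ᵐ κ ∂(volume.restrict (Set.Ioo 0 R)), κ ∈ Set.Ioo 0 R :=
    ae_restrict_mem measurableSet_Ioo
  set s : Set (Plane × ℝ × ℝ) := {x | x.2.1 < x.2.2 ∧ x.2.2 < x.2.1 + 2 * Real.pi} with hs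
  have hs_nhds : s ∈ 𝓝 x₀ := by
    have h2 : ∀ᶠ x : Plane × ℝ × ℝ in 𝓝 x₀, x.2.1 < x.2.2 :=
      (isOpen_lt (by fun_prop) (by fun_prop)).mem_nhds hx₀
    have h3 : ∀ᶠ x : Plane × ℝ × ℝ in 𝓝 x₀, x.2.2 < x.2.1 + 2 * Real.pi :=
      (isOpen_lt (by fun_prop) (by fun_prop)).mem_nhds hx₀'
    exact h2.and h3
  have hI1 := integrableOn_barForm_smulRight hf hB R x₀.1 x₀.2.1
  have hI2 := integrableOn_barForm_smulRight hf hB R x₀.1 x₀.2.2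
  have hJ1 := ((ContinuousLinearMap.compL ℝ (Plane × ℝ × ℝ) (Plane × ℝ) E).flip
    firstBar).integrable_comp hI1
  have hJ2 := ((ContinuousLinearMap.compL ℝ (Plane × ℝ × ℝ) (Plane × ℝ) E).flip
    lastBar).integrable_comp hI2
  -- The Lipschitz estimate is needed only against the base point `x₀`, which is the centre of the
  -- circles; differentiability at that point asks for no more.
  have key := hasFDerivAt_integral_of_dominated_loc_of_lip' (𝕜 := ℝ)
    (μ := volume.restrict (Set.Ioo 0 R)) (F := arcIntegral f x₀.1) (x₀ := x₀) (s := s)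
    (bound := fun _ => B * (2 * R + 4 * Real.pi))
    (F' := fun κ => ((barForm x₀.2.2 κ).smulRight (f (pointer x₀.1 x₀.2.2 κ))).comp lastBar
        - ((barForm x₀.2.1 κ).smulRight (f (pointer x₀.1 x₀.2.1 κ))).comp firstBar)
    hs_nhds (fun x _ => aestronglyMeasurable_arcIntegral hf _ _ _)
    (Measure.integrableOn_of_bounded (M := R * (B * (2 * Real.pi))) (by simp)
      (aestronglyMeasurable_arcIntegral hf _ _ _) (by
        filter_upwards [hpos] with κ hκ
        refine (norm_arcIntegral_le hB x₀.1 hκ.1.le x₀).trans ?_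
        have := Real.pi_pos
        gcongr
        exact hκ.2.le))
    (hJ2.sub hJ1).aestronglyMeasurable
    (by
      filter_upwards [hpos] with κ hκ x hx
      refine (norm_arcIntegral_sub_le hf hB hκ.1 hx₀.le hx₀' hx.1.le hx.2).trans ?_
      gcongr
      exact hκ.2.le)
    (by
      have : IntegrableOn (fun _ : ℝ => B * (2 * R + 4 * Real.pi)) (Set.Ioo 0 R) :=
        integrableOn_const (by simp)
      exact this)
    (by
      filter_upwards [hpos, hca, hcb] with κ hκ h1 h2
      exact hasFDerivAt_arcIntegral hf hB hκ.1 hx₀ hx₀' h1 h2)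
  have h := key.2
  have hfun : (fun x => ∫ κ in Set.Ioo 0 R, arcIntegral f x₀.1 x κ) = sectorIntegral f :=
    funext fun x => (sectorIntegral_eq hf hB hR x).symm
  rw [hfun] at h
  refine h.congr_fderiv ?_
  have := integral_sub hJ2 hJ1
  rw [ContinuousLinearMap.integral_comp_comm _ hI1,
    ContinuousLinearMap.integral_comp_comm _ hI2] at this
  exact this

/-! ### Lower bounds from a disc about the apex. -/

/-- A lower bound for the integral of a nonnegative function that is bounded below on a disc about
the apex of the sector. -/
lemma le_sectorIntegral {f : Plane → ℝ} (hf : StronglyMeasurable f) {B : ℝ}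
    (hB : ∀ q, ‖f q‖ ≤ B) (hf0 : ∀ q, 0 ≤ f q) {p : Plane} {a b R δ c : ℝ}
    (hR : ∀ q, R ≤ dist q p → f q = 0) (hδ : 0 ≤ δ) (hδR : δ ≤ R)
    (hc : ∀ q, dist q p < δ → c ≤ f q) (hab : a ≤ b) (hb : b < a + 2 * Real.pi) :
    c * (b - a) * (δ ^ 2 / 2) ≤ sectorIntegral f (p, a, b) := by
  rw [sectorIntegral_eq hf hB (p₀ := p) hR]
  have hint : IntegrableOn (arcIntegral f p (p, a, b)) (Set.Ioo 0 R) :=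
    Measure.integrableOn_of_bounded (M := R * (B * (2 * Real.pi))) (by simp)
      (aestronglyMeasurable_arcIntegral hf _ _ _) (by
        filter_upwards [ae_restrict_mem measurableSet_Ioo] with κ hκ
        refine (norm_arcIntegral_le hB p hκ.1.le _).trans ?_
        have := Real.pi_pos
        have hB0 : 0 ≤ B := (norm_nonneg _).trans (hB 0)
        gcongr
        exact hκ.2.le)
  have heq : ∀ κ, 0 < κ → arcIntegral f p (p, a, b) κ = κ * ∫ θ in a..b, f (pointer p θ κ) := by
    intro κ hκ
    rw [arcIntegral_eq hf hB (by simpa using hκ) hab hb, sub_self, circleAngle_zero,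
      circleAngle_zero, smul_eq_mul]
  -- Since `f ≥ 0`, radii beyond `δ` can be dropped; on the disc the Jacobian `κ` integrates to `δ²
  -- / 2`.
  have h1 : ∫ κ in Set.Ioo 0 δ, arcIntegral f p (p, a, b) κ
      ≤ ∫ κ in Set.Ioo 0 R, arcIntegral f p (p, a, b) κ := by
    refine setIntegral_mono_set hint ?_ (Set.Ioo_subset_Ioo_right hδR).eventuallyLE
    filter_upwards [ae_restrict_mem measurableSet_Ioo] with κ hκ
    rw [heq κ hκ.1]
    exact mul_nonneg hκ.1.le (intervalIntegral.integral_nonneg hab fun _ _ => hf0 _)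
  refine le_trans ?_ h1
  have h2 : ∫ κ in Set.Ioo 0 δ, κ * (c * (b - a)) = c * (b - a) * (δ ^ 2 / 2) := by
    rw [← integral_Ioc_eq_integral_Ioo, ← intervalIntegral.integral_of_le hδ,
      intervalIntegral.integral_mul_const, integral_id]
    ring
  rw [← h2]
  refine setIntegral_mono_on ?_ (hint.mono_set (Set.Ioo_subset_Ioo_right hδR)) measurableSet_Ioo
    fun κ hκ => ?_
  · exact ((Continuous.integrableOn_Icc (by fun_prop)).mono_set Set.Ioo_subset_Icc_self)
  · rw [heq κ hκ.1]
    refine mul_le_mul_of_nonneg_left ?_ hκ.1.le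
    have := intervalIntegral.integral_mono_on hab (f := fun _ => c) (μ := volume)
      (g := fun θ => f (pointer p θ κ)) (by simp)
      (intervalIntegrable_comp_pointer hf hB p κ a b)
      fun θ _ => hc _ (by rw [dist_pointer p θ hκ.1.le]; exact hκ.2)
    simpa [mul_comm] using this

/-- A lower bound for the angular derivative. -/
lemma le_barDeriv_angle {f : Plane → ℝ} (hf : StronglyMeasurable f) {B : ℝ}
    (hB : ∀ q, ‖f q‖ ≤ B) (hf0 : ∀ q, 0 ≤ f q) {p : Plane} {R δ c : ℝ} (hδ : 0 ≤ δ) (hδR : δ ≤ R)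
    (hc : ∀ q, dist q p < δ → c ≤ f q) (θ : ℝ) :
    c * (δ ^ 2 / 2) ≤ barDeriv f R p θ (0, 1) := by
  have hint := (integrableOn_barForm_smulRight hf hB R p θ).apply_continuousLinearMap (0, 1)
  simp only [ContinuousLinearMap.smulRight_apply, barForm_apply, mul_one, inner_zero_right,
    add_zero] at hint
  rw [barDeriv_angle hf hB]
  have h1 : ∫ κ in Set.Ioo 0 δ, κ • f (pointer p θ κ) ≤ ∫ κ in Set.Ioo 0 R, κ • f (pointer p θ κ) := by
    refine setIntegral_mono_set hint ?_ (Set.Ioo_subset_Ioo_right hδR).eventuallyLE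
    filter_upwards [ae_restrict_mem measurableSet_Ioo] with κ hκ
    exact mul_nonneg hκ.1.le (hf0 _)
  refine le_trans ?_ h1
  have h2 : ∫ κ in Set.Ioo 0 δ, κ * c = c * (δ ^ 2 / 2) := by
    rw [← integral_Ioc_eq_integral_Ioo, ← intervalIntegral.integral_of_le hδ,
      intervalIntegral.integral_mul_const, integral_id]
    ring
  rw [← h2]
  refine setIntegral_mono_on ?_
    (IntegrableOn.mono_set hint (Set.Ioo_subset_Ioo_right hδR)) measurableSet_Ioo fun κ hκ => ?_
  · exact ((Continuous.integrableOn_Icc (by fun_prop)).mono_set Set.Ioo_subset_Icc_self)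
  · exact mul_le_mul_of_nonneg_left
      (hc _ (by rw [dist_pointer p θ hκ.1.le]; exact hκ.2)) hκ.1.le

end

/-! ### A Barbalat-type lemma and algebra on the cycle. -/

noncomputable section

/-- A quantity with bounded derivative tends to zero if its square is dissipated by a function that
is bounded below. -/
lemma tendsto_zero_of_dissipation {F : Type*} [NormedAddCommGroup F] [NormedSpace ℝ F]
    {f f' : ℝ → F} {V V' : ℝ → ℝ} {c K b : ℝ} (hc : 0 < c)
    (hf : ∀ t, 0 ≤ t → HasDerivWithinAt f (f' t) (Set.Ici 0) t) (hK : ∀ t, 0 ≤ t → ‖f' t‖ ≤ K)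
    (hV : ∀ t, 0 ≤ t → HasDerivWithinAt V (V' t) (Set.Ici 0) t)
    (hV' : ∀ t, 0 ≤ t → V' t ≤ -(c * ‖f t‖ ^ 2)) (hb : ∀ t, 0 ≤ t → b ≤ V t) :
    Tendsto f atTop (𝓝 0) := by
  have hK0 : 0 ≤ K := (norm_nonneg _).trans (hK 0 le_rfl)
  have hdec : ∀ s t η : ℝ, 0 ≤ s → s ≤ t → (∀ u ∈ Set.Icc s t, V' u ≤ -η) →
      V t ≤ V s - η * (t - s) := by
    intro s t η hs hst hη
    have := image_le_of_deriv_right_le_deriv_boundary (f := V) (f' := V') (a := s) (b := t)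
      (B := fun u => V s - η * (u - s)) (B' := fun _ => -η)
      (fun u hu => ((hV u (hs.trans hu.1)).continuousWithinAt).mono
        fun w hw => hs.trans hw.1)
      (fun u hu => (hV u (hs.trans hu.1)).mono (Set.Ici_subset_Ici.2 (hs.trans hu.1)))
      (by simp) (by fun_prop)
      (fun u _ => by
        have : HasDerivAt (fun u : ℝ => V s - η * (u - s)) (-η) u := by
          simpa using (((hasDerivAt_id u).sub_const s).const_mul η).const_sub (V s)
        exact this.hasDerivWithinAt)
      (fun u hu => hη u ⟨hu.1, hu.2.le⟩)
    exact this ⟨hst, le_rfl⟩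
  have hanti : ∀ s t : ℝ, 0 ≤ s → s ≤ t → V t ≤ V s := fun s t hs hst => by
    have := hdec s t 0 hs hst fun u hu => (hV' u (hs.trans hu.1)).trans (by
      have : 0 ≤ c * ‖f u‖ ^ 2 := by positivity
      linarith)
    simpa using this
  have hlip : ∀ s t : ℝ, 0 ≤ s → 0 ≤ t → ‖f t - f s‖ ≤ K * ‖t - s‖ := fun s t hs ht =>
    (convex_Ici (0 : ℝ)).norm_image_sub_le_of_norm_hasDerivWithin_le
      (fun x hx => hf x hx) (fun x hx => hK x hx) hs ht
  rw [Metric.tendsto_atTop]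
  intro ε hε
  -- During a time `δ` the norm of `f` drops by at most `ε / 2`; `K + 1` covers the case `K = 0`.
  set δ : ℝ := ε / (2 * (K + 1)) with hδ
  have hδ0 : 0 < δ := by positivity
  have hKδ : K * δ ≤ ε / 2 := by
    rw [hδ]
    have : K * (ε / (2 * (K + 1))) = ε / 2 * (K / (K + 1)) := by field_simp
    rw [this]
    have h1 : K / (K + 1) ≤ 1 := by rw [div_le_one (by linarith)]; linarith
    nlinarith
  set η : ℝ := c * (ε / 2) ^ 2 with hη
  have hη0 : 0 < η := by positivity
  have hbdd : BddBelow (V '' Set.Ici 0) := ⟨b, by rintro _ ⟨t, ht, rfl⟩; exact hb t ht⟩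
  -- After `t₀` less than `η δ` of energy is left above the infimum, whereas a value of norm at
  -- least `ε` would cost `η δ` within time `δ`.
  obtain ⟨_, ⟨t₀, ht₀, rfl⟩, hlt⟩ := exists_lt_of_csInf_lt
    (Set.Nonempty.image V ⟨0, le_rfl⟩) (show sInf (V '' Set.Ici 0) < sInf (V '' Set.Ici 0) + η * δ by
      have := mul_pos hη0 hδ0
      linarith)
  refine ⟨t₀, fun t ht => ?_⟩
  rw [dist_zero_right]
  by_contra hcon
  push Not at hcon
  have ht0 : 0 ≤ t := le_trans ht₀ ht
  have h1 := hdec t (t + δ) η ht0 (by linarith) fun u hu => by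
    have hu0 : 0 ≤ u := ht0.trans hu.1
    have h2 := hlip t u ht0 hu0
    have h3 : ‖u - t‖ ≤ δ := by
      rw [Real.norm_of_nonneg (by linarith [hu.1])]; linarith [hu.2]
    have h4 : ‖f t‖ - ‖f u‖ ≤ ‖f u - f t‖ := by
      rw [norm_sub_rev]; exact norm_sub_norm_le _ _
    have h5 : ε / 2 ≤ ‖f u‖ := by nlinarith [mul_le_mul_of_nonneg_left h3 hK0]
    have h6 : (ε / 2) ^ 2 ≤ ‖f u‖ ^ 2 := pow_le_pow_left₀ (by positivity) h5 2
    have := hV' u hu0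
    rw [hη]
    nlinarith
  have h2 := hanti t₀ t ht₀ ht
  have h3 : sInf (V '' Set.Ici 0) ≤ V (t + δ) :=
    csInf_le hbdd ⟨t + δ, by show (0 : ℝ) ≤ t + δ; linarith, rfl⟩
  rw [add_sub_cancel_left] at h1
  linarith

variable {N : ℕ} [NeZero N]

lemma sum_shift {M : Type*} [AddCommMonoid M] (u : Fin N → M) : ∑ i, u (i + 1) = ∑ i, u i :=
  Equiv.sum_comp (Equiv.addRight (1 : Fin N)) u

lemma sum_shift_sub {M : Type*} [AddCommMonoid M] (u : Fin N → M) : ∑ i, u (i - 1) = ∑ i, u i :=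
  Equiv.sum_comp (Equiv.subRight (1 : Fin N)) u

open Fin.NatCast Fin.CommRing in
/-- A family of sum zero is controlled by its weighted cyclic differences. -/
lemma exists_cyclic_bound (N : ℕ) [NeZero N] {g₀ g₁ : ℝ} (hg₀ : 0 < g₀) (hg₁ : 0 ≤ g₁) :
    ∃ C : ℝ, 0 ≤ C ∧ ∀ (D g g' : Fin N → ℝ) (X : ℝ), 0 ≤ X → (∀ i, g₀ ≤ g i) →
      (∀ i, 0 ≤ g' i ∧ g' i ≤ g₁) → ∑ i, D i = 0 →
      (∀ i, |D i * g i - D (i - 1) * g' i| ≤ X) → ∀ i, |D i| ≤ C * X := by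
  -- The recursion comes from `g₀ D_{i+1} ≤ X + g₁ c_k X` when `D_{i+1} ≥ 0` and `D_i ≤ c_k X`. It
  -- starts at `0` at an index where `D` is nonpositive, which exists because the sum vanishes.
  set c : ℕ → ℝ := fun k => Nat.rec 0 (fun _ c => (g₁ * c + 1) / g₀) k with hcdef
  have hc0 : c 0 = 0 := rfl
  have hcs : ∀ k, c (k + 1) = (g₁ * c k + 1) / g₀ := fun k => rfl
  have hcn : ∀ k, 0 ≤ c k := by
    intro k
    induction k with
    | zero => exact hc0.ge
    | succ k ih => rw [hcs]; positivity
  have hmain : ∀ (D g g' : Fin N → ℝ) (X : ℝ), 0 ≤ X → (∀ i, g₀ ≤ g i) →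
      (∀ i, 0 ≤ g' i ∧ g' i ≤ g₁) → ∑ i, D i = 0 →
      (∀ i, |D i * g i - D (i - 1) * g' i| ≤ X) → ∀ i, D i ≤ (∑ k ∈ Finset.range N, c k) * X := by
    intro D g g' X hX hg hg' hsum hD i
    obtain ⟨j, -, hj⟩ := Finset.exists_le_of_sum_le (s := (Finset.univ : Finset (Fin N)))
      (f := D) (g := fun _ => 0) Finset.univ_nonempty (by simp [hsum])
    have hind : ∀ k : ℕ, D (j + (k : Fin N)) ≤ c k * X := by
      intro k
      induction k with
      | zero => simpa [hc0] using hj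
      | succ k ih =>
        set i' : Fin N := j + ((k + 1 : ℕ) : Fin N) with hi'
        have hi'' : i' - 1 = j + (k : Fin N) := by
          rw [hi']; push_cast; abel
        have h1 := (abs_le.1 (hD i')).2
        rw [hi''] at h1
        obtain ⟨h2, h3⟩ := hg' i'
        have h4 := hg i'
        have hckX : 0 ≤ c k * X := mul_nonneg (hcn k) hX
        have h5 : D (j + (k : Fin N)) * g' i' ≤ c k * X * g₁ :=
          (mul_le_mul_of_nonneg_right ih h2).trans (mul_le_mul_of_nonneg_left h3 hckX)
        rw [hcs, div_mul_eq_mul_div, le_div_iff₀ hg₀]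
        rcases le_total (D i') 0 with h6 | h6
        · have : 0 ≤ (g₁ * c k + 1) * X := by have := hcn k; positivity
          nlinarith
        · nlinarith
    have h := hind (i - j).val
    rw [Fin.cast_val_eq_self, add_sub_cancel] at h
    refine h.trans (mul_le_mul_of_nonneg_right ?_ hX)
    exact Finset.single_le_sum (fun k _ => hcn k) (Finset.mem_range.2 (i - j).isLt)
  refine ⟨∑ k ∈ Finset.range N, c k, Finset.sum_nonneg fun k _ => hcn k, ?_⟩
  intro D g g' X hX hg hg' hsum hD i
  refine abs_le.2 ⟨?_, hmain D g g' X hX hg hg' hsum hD i⟩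
  have := hmain (fun i => -D i) g g' X hX hg hg' (by simp [hsum]) (fun i => by
    rw [← abs_neg]
    refine le_trans (le_of_eq ?_) (hD i)
    congr 1
    ring) i
  linarith

/-- The cyclic second difference `2 u_i - u_{i-1} - u_{i+1}`. -/
def cyclicDiff {F : Type*} [AddCommGroup F] [Module ℝ F] (u : Fin N → F) (i : Fin N) : F :=
  (2 : ℝ) • u i - u (i - 1) - u (i + 1)

lemma sum_cyclicDiff {F : Type*} [AddCommGroup F] [Module ℝ F] (u : Fin N → F) :
    ∑ i, cyclicDiff u i = 0 := by
  simp only [cyclicDiff, Finset.sum_sub_distrib]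
  rw [sum_shift u, sum_shift_sub u, ← Finset.smul_sum, two_smul]
  abel

/-- Summation by parts on a cycle leaves no boundary terms. It turns the derivative of the energy
into a pairing with second differences. -/
lemma sum_inner_diff_diff {F : Type*} [NormedAddCommGroup F] [InnerProductSpace ℝ F]
    (u w : Fin N → F) :
    ∑ i, inner ℝ (u i - u (i + 1)) (w i - w (i + 1)) = ∑ i, inner ℝ (cyclicDiff u i) (w i) := by
  have h := sum_shift (N := N) fun i => inner ℝ (u (i - 1) - u i) (w i)
  simp only [add_sub_cancel_right] at h
  simp only [inner_sub_right (𝕜 := ℝ) (_ - _), Finset.sum_sub_distrib]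
  rw [h, ← Finset.sum_sub_distrib]
  refine Finset.sum_congr rfl fun i _ => ?_
  rw [← inner_sub_left, cyclicDiff, two_smul]
  congr 1
  abel

lemma hasDerivWithinAt_cyclicDiff {F : Type*} [NormedAddCommGroup F] [NormedSpace ℝ F]
    {u : ℝ → Fin N → F} {u' : Fin N → F} {s : Set ℝ} {t : ℝ}
    (h : ∀ i, HasDerivWithinAt (fun τ => u τ i) (u' i) s t) (i : Fin N) :
    HasDerivWithinAt (fun τ => cyclicDiff (u τ) i) (cyclicDiff u' i) s t :=
  (((h i).const_smul (2 : ℝ)).sub (h (i - 1))).sub (h (i + 1))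

lemma norm_cyclicDiff_le {F : Type*} [NormedAddCommGroup F] [NormedSpace ℝ F] {u : Fin N → F}
    {C : ℝ} (h : ∀ i, ‖u i‖ ≤ C) (i : Fin N) : ‖cyclicDiff u i‖ ≤ 4 * C := by
  have h1 : ‖(2 : ℝ) • u i‖ ≤ 2 * C := by
    rw [norm_smul, Real.norm_of_nonneg (by norm_num)]
    linarith [h i]
  calc ‖cyclicDiff u i‖ ≤ ‖(2 : ℝ) • u i‖ + ‖u (i - 1)‖ + ‖u (i + 1)‖ :=
        (norm_sub_le _ _).trans (add_le_add_left (norm_sub_le _ _) _)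
    _ ≤ 4 * C := by linarith [h (i - 1), h (i + 1)]

/-! ### Energy decay and convergence of the descent. -/

/-- Along the gradient descent direction the energy decreases at the rate of the squared
velocities. -/
lemma energy_identity {κφ κr : ℝ} (hκφ : κφ ≠ 0) (hκr : κr ≠ 0)
    (D Ma Mb φd : Fin N → ℝ) (G E rd : Fin N → Plane)
    (hφd : ∀ i, φd i = -κφ * (D i * Ma i + D (i - 1) * Mb (i - 1)))
    (hrd : ∀ i, rd i = -κr • (D i • G i + E i)) :
    ∑ i, D i * (inner ℝ (G i) (rd i) + Ma i * φd i + Mb i * φd (i + 1))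
      + ∑ i, inner ℝ (E i) (rd i)
      = -(∑ i, φd i ^ 2 / κφ + ∑ i, ‖rd i‖ ^ 2 / κr) := by
  have h1 := sum_shift (N := N) fun i => D (i - 1) * Mb (i - 1) * φd i
  simp only [add_sub_cancel_right] at h1
  -- Only one factor of the square is replaced by the equation of motion, which leaves a pairing of
  -- the gradient with the velocity.
  have h2 : ∀ i, φd i ^ 2 / κφ = -(D i * Ma i * φd i) - D (i - 1) * Mb (i - 1) * φd i := by
    intro i
    rw [div_eq_iff hκφ, pow_two]
    nth_rewrite 1 [hφd i]
    ring
  have h3 : ∀ i, ‖rd i‖ ^ 2 / κr = -(D i * inner ℝ (G i) (rd i)) - inner ℝ (E i) (rd i) := by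
    intro i
    rw [div_eq_iff hκr, ← real_inner_self_eq_norm_sq]
    nth_rewrite 1 [hrd i]
    rw [real_inner_smul_left, inner_add_left, real_inner_smul_left]
    ring
  simp only [h2, h3, mul_add, Finset.sum_add_distrib, Finset.sum_sub_distrib,
    Finset.sum_neg_distrib]
  rw [← h1]
  simp only [mul_assoc]
  ring

/-- Convergence of the cyclic gradient descent under uniform bounds on the partial derivatives. -/
theorem tendsto_zero_of_cyclic_descent {κφ κr g₀ g₁ Cg Cm Cr : ℝ} (hκφ : 0 < κφ) (hκr : 0 < κr)
    (hg₀ : 0 < g₀) (hg₁ : 0 ≤ g₁)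
    {m Ma Mb φd : ℝ → Fin N → ℝ} {r G rd : ℝ → Fin N → Plane}
    (hφd : ∀ t, 0 ≤ t → ∀ i, φd t i = -κφ * (cyclicDiff (m t) i * Ma t i
      + cyclicDiff (m t) (i - 1) * Mb t (i - 1)))
    (hrd : ∀ t, 0 ≤ t → ∀ i, rd t i = -κr • (cyclicDiff (m t) i • G t i + cyclicDiff (r t) i))
    (hm : ∀ t, 0 ≤ t → ∀ i, HasDerivWithinAt (fun s => m s i)
      (inner ℝ (G t i) (rd t i) + Ma t i * φd t i + Mb t i * φd t (i + 1)) (Set.Ici 0) t)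
    (hr : ∀ t, 0 ≤ t → ∀ i, HasDerivWithinAt (fun s => r s i) (rd t i) (Set.Ici 0) t)
    (hMa : ∀ t, 0 ≤ t → ∀ i, g₀ ≤ -Ma t i ∧ -Ma t i ≤ g₁)
    (hMb : ∀ t, 0 ≤ t → ∀ i, g₀ ≤ Mb t i ∧ Mb t i ≤ g₁)
    (hG : ∀ t, 0 ≤ t → ∀ i, ‖G t i‖ ≤ Cg) (hmC : ∀ t, 0 ≤ t → ∀ i, ‖m t i‖ ≤ Cm)
    (hrC : ∀ t, 0 ≤ t → ∀ i, ‖r t i‖ ≤ Cr) (i : Fin N) :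
    Tendsto (fun t => cyclicDiff (m t) i) atTop (𝓝 0) ∧ Tendsto (fun t => φd t i) atTop (𝓝 0) ∧
      Tendsto (fun t => rd t i) atTop (𝓝 0) := by
  have hCg : 0 ≤ Cg := (norm_nonneg _).trans (hG 0 le_rfl i)
  have hCm : 0 ≤ Cm := (norm_nonneg _).trans (hmC 0 le_rfl i)
  have hCr : 0 ≤ Cr := (norm_nonneg _).trans (hrC 0 le_rfl i)
  have hMa' : ∀ t, 0 ≤ t → ∀ i, |Ma t i| ≤ g₁ := fun t ht i => by
    obtain ⟨h1, h2⟩ := hMa t ht i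
    rw [← abs_neg, abs_of_nonneg (hg₀.le.trans h1)]; exact h2
  have hMb' : ∀ t, 0 ≤ t → ∀ i, |Mb t i| ≤ g₁ := fun t ht i => by
    obtain ⟨h1, h2⟩ := hMb t ht i
    rw [abs_of_nonneg (hg₀.le.trans h1)]; exact h2
  have hD : ∀ t, 0 ≤ t → ∀ i, |cyclicDiff (m t) i| ≤ 4 * Cm := fun t ht =>
    norm_cyclicDiff_le (hmC t ht)
  -- bounds for the velocities
  set Bφ : ℝ := κφ * (4 * Cm * g₁ + 4 * Cm * g₁) with hBφ
  set Br : ℝ := κr * (4 * Cm * Cg + 4 * Cr) with hBr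
  have hφB : ∀ t, 0 ≤ t → ∀ i, |φd t i| ≤ Bφ := fun t ht i => by
    rw [hφd t ht i, abs_mul, abs_neg, abs_of_pos hκφ]
    refine mul_le_mul_of_nonneg_left ((abs_add_le _ _).trans ?_) hκφ.le
    rw [abs_mul, abs_mul]
    have := hD t ht i
    have := hD t ht (i - 1)
    have := hMa' t ht i
    have := hMb' t ht (i - 1)
    gcongr
  have hrB : ∀ t, 0 ≤ t → ∀ i, ‖rd t i‖ ≤ Br := fun t ht i => by
    rw [hrd t ht i, norm_smul, norm_neg, Real.norm_of_nonneg hκr.le]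
    refine mul_le_mul_of_nonneg_left ((norm_add_le _ _).trans ?_) hκr.le
    rw [norm_smul, Real.norm_eq_abs]
    have := hD t ht i
    have := hG t ht i
    have := norm_cyclicDiff_le (hrC t ht) i
    gcongr
  -- the energy
  set md : ℝ → Fin N → ℝ := fun t i =>
    inner ℝ (G t i) (rd t i) + Ma t i * φd t i + Mb t i * φd t (i + 1) with hmd
  have hmdB : ∀ t, 0 ≤ t → ∀ i, ‖md t i‖ ≤ Cg * Br + g₁ * Bφ + g₁ * Bφ := fun t ht i => by
    refine (norm_add₃_le).trans ?_
    have h1 : ‖inner ℝ (G t i) (rd t i)‖ ≤ Cg * Br :=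
      (norm_inner_le_norm _ _).trans
        (mul_le_mul (hG t ht i) (hrB t ht i) (norm_nonneg _) hCg)
    have h2 : ‖Ma t i * φd t i‖ ≤ g₁ * Bφ := by
      rw [norm_mul]
      exact mul_le_mul (hMa' t ht i) (hφB t ht i) (norm_nonneg _) hg₁
    have h3 : ‖Mb t i * φd t (i + 1)‖ ≤ g₁ * Bφ := by
      rw [norm_mul]
      exact mul_le_mul (hMb' t ht i) (hφB t ht _) (norm_nonneg _) hg₁
    linarith
  set V : ℝ → ℝ := fun t =>
    ∑ i, ‖m t i - m t (i + 1)‖ ^ 2 + ∑ i, ‖r t i - r t (i + 1)‖ ^ 2 with hVdef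
  set S₁ : ℝ → ℝ := fun t => ∑ i, φd t i ^ 2 / κφ with hS₁
  set S₂ : ℝ → ℝ := fun t => ∑ i, ‖rd t i‖ ^ 2 / κr with hS₂
  have hV : ∀ t, 0 ≤ t → HasDerivWithinAt V (-2 * (S₁ t + S₂ t)) (Set.Ici 0) t := by
    intro t ht
    have h1 := HasDerivWithinAt.fun_sum (u := (Finset.univ : Finset (Fin N)))
      fun i _ => ((hm t ht i).sub (hm t ht (i + 1))).norm_sq
    have h2 := HasDerivWithinAt.fun_sum (u := (Finset.univ : Finset (Fin N)))
      fun i _ => ((hr t ht i).sub (hr t ht (i + 1))).norm_sq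
    refine (h1.add h2).congr_deriv ?_
    rw [← Finset.mul_sum, ← Finset.mul_sum]
    have h3 := sum_inner_diff_diff (m t) (md t)
    have h4 := sum_inner_diff_diff (r t) (rd t)
    have h5 := energy_identity hκφ.ne' hκr.ne' (cyclicDiff (m t)) (Ma t) (Mb t) (φd t) (G t)
      (cyclicDiff (r t)) (rd t) (hφd t ht) (hrd t ht)
    have h6 : ∑ i, inner ℝ (cyclicDiff (m t) i) (md t i) = ∑ i, cyclicDiff (m t) i * md t i :=
      Finset.sum_congr rfl fun i _ => by
      rw [RCLike.inner_apply, conj_trivial, mul_comm]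
    simp only [Pi.sub_apply] at *
    rw [h4]
    rw [h6] at h3
    have h7 : ∑ i, inner ℝ (m t i - m t (i + 1)) (md t i - md t (i + 1)) + ∑ i, inner ℝ (cyclicDiff (r t) i) (rd t i) = -(S₁ t + S₂ t) := by
      rw [h3]; exact h5
    simp only [hmd] at h7
    linear_combination 2 * h7
  have hV0 : ∀ t, 0 ≤ t → 0 ≤ V t := fun t _ => by positivity
  have hS₁n : ∀ t, 0 ≤ S₁ t := fun t => by positivity
  have hS₂n : ∀ t, 0 ≤ S₂ t := fun t => by positivity
  -- the workload differences are controlled by the angular velocities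
  obtain ⟨C, hC, hCyc⟩ := exists_cyclic_bound N hg₀ hg₁
  have hDS : ∀ t, 0 ≤ t → ∀ i, κφ / (C ^ 2 + 1) * ‖cyclicDiff (m t) i‖ ^ 2 ≤ S₁ t := by
    intro t ht i
    -- The angular equation gives `φ̇_i / κφ` for the weighted difference, with weights `-Ma` and
    -- the shifted `Mb`. The Euclidean norm `X` bounds all of these at once, and `X²` is `S₁ / κφ`.
    set X : ℝ := Real.sqrt (∑ i, (φd t i / κφ) ^ 2) with hX
    have h1 := hCyc (cyclicDiff (m t)) (fun i => -Ma t i) (fun i => Mb t (i - 1)) X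
      (Real.sqrt_nonneg _) (fun i => (hMa t ht i).1)
      (fun i => ⟨hg₀.le.trans (hMb t ht _).1, (hMb t ht _).2⟩) (sum_cyclicDiff _) (fun i => by
        have : cyclicDiff (m t) i * -Ma t i - cyclicDiff (m t) (i - 1) * Mb t (i - 1)
            = φd t i / κφ := by
          rw [hφd t ht i]; field_simp; ring
        rw [this]
        refine Real.abs_le_sqrt ?_
        exact Finset.single_le_sum (f := fun i => (φd t i / κφ) ^ 2) (fun i _ => sq_nonneg _)
          (Finset.mem_univ i)) i
    have h2 : ‖cyclicDiff (m t) i‖ ^ 2 ≤ C ^ 2 * (S₁ t / κφ) := by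
      have h3 := pow_le_pow_left₀ (abs_nonneg _) h1 2
      rw [mul_pow, Real.sq_sqrt (by positivity)] at h3
      refine h3.trans (le_of_eq ?_)
      congr 1
      rw [hS₁, Finset.sum_div]
      exact Finset.sum_congr rfl fun i _ => by field_simp
    rw [div_mul_eq_mul_div, div_le_iff₀ (by positivity)]
    calc κφ * ‖cyclicDiff (m t) i‖ ^ 2 ≤ κφ * (C ^ 2 * (S₁ t / κφ)) := by gcongr
      _ = C ^ 2 * S₁ t := by field_simp
      _ ≤ S₁ t * (C ^ 2 + 1) := by nlinarith [hS₁n t]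
  have hDlim : ∀ i, Tendsto (fun t => cyclicDiff (m t) i) atTop (𝓝 0) := fun i =>
    tendsto_zero_of_dissipation (c := κφ / (C ^ 2 + 1)) (by positivity)
      (fun t ht => hasDerivWithinAt_cyclicDiff (hm t ht) i)
      (fun t ht => norm_cyclicDiff_le (hmdB t ht) i) hV
      (fun t ht => by linarith [hDS t ht i, hS₁n t, hS₂n t]) hV0
  have hbdd : ∀ {f : ℝ → ℝ} {b : ℝ}, (∀ t, 0 ≤ t → |f t| ≤ b) →
      IsBoundedUnder (· ≤ ·) atTop ((‖·‖) ∘ f) := fun {f b} hf =>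
    isBoundedUnder_of_eventually_le (a := b) ((eventually_ge_atTop 0).mono hf)
  have hφlim : Tendsto (fun t => φd t i) atTop (𝓝 0) := by
    have h1 := (hDlim i).zero_mul_isBoundedUnder_le (hbdd fun t ht => hMa' t ht i)
    have h2 := (hDlim (i - 1)).zero_mul_isBoundedUnder_le (hbdd fun t ht => hMb' t ht (i - 1))
    have h3 := (h1.add h2).const_mul (-κφ)
    rw [add_zero, mul_zero] at h3
    exact h3.congr' ((eventually_ge_atTop 0).mono fun t ht => (hφd t ht i).symm)
  have hGD : Tendsto (fun t => cyclicDiff (m t) i • G t i) atTop (𝓝 0) := by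
    refine (hDlim i).zero_smul_isBoundedUnder_le
      (isBoundedUnder_of_eventually_le (a := Cg) ((eventually_ge_atTop 0).mono fun t ht => ?_))
    exact hG t ht i
  have hElim : Tendsto (fun t => cyclicDiff (r t) i) atTop (𝓝 0) := by
    set c₁ : ℝ := κφ / (C ^ 2 + 1) with hc₁
    have hc₁0 : 0 < c₁ := by positivity
    -- From `E = -ṙ / κr - D G` and `(x + y)² ≤ 2x² + 2y²` one gets `|E|² ≤ 2 A (S₁ + S₂)`, so the
    -- energy dissipates `|E|² / A`.
    set A : ℝ := 1 / κr + Cg ^ 2 / c₁ with hA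
    have hA0 : 0 < A := by positivity
    refine tendsto_zero_of_dissipation (c := 1 / A) (by positivity)
      (fun t ht => hasDerivWithinAt_cyclicDiff (hr t ht) i)
      (fun t ht => norm_cyclicDiff_le (hrB t ht) i) hV (fun t ht => ?_) hV0
    have h1 : cyclicDiff (r t) i = -(κr⁻¹ • rd t i) - cyclicDiff (m t) i • G t i := by
      rw [hrd t ht i, neg_smul, smul_neg, neg_neg, smul_smul, inv_mul_cancel₀ hκr.ne', one_smul]
      abel
    have h2 : ‖cyclicDiff (r t) i‖ ≤ ‖rd t i‖ / κr + ‖cyclicDiff (m t) i‖ * Cg := by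
      rw [h1]
      refine (norm_sub_le _ _).trans (add_le_add ?_ ?_)
      · rw [norm_neg, norm_smul, norm_inv, Real.norm_of_nonneg hκr.le, inv_mul_eq_div]
      · rw [norm_smul]
        exact mul_le_mul_of_nonneg_left (hG t ht i) (norm_nonneg _)
    have h3 : ‖rd t i‖ ^ 2 / κr ≤ S₂ t :=
      Finset.single_le_sum (f := fun i => ‖rd t i‖ ^ 2 / κr) (fun i _ => by positivity)
        (Finset.mem_univ i)
    have h4 := hDS t ht i
    have h5 : ‖cyclicDiff (r t) i‖ ^ 2 ≤ 2 * (‖rd t i‖ / κr) ^ 2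
        + 2 * (‖cyclicDiff (m t) i‖ * Cg) ^ 2 := by
      have := pow_le_pow_left₀ (norm_nonneg _) h2 2
      nlinarith [sq_nonneg (‖rd t i‖ / κr - ‖cyclicDiff (m t) i‖ * Cg)]
    have h6 : (‖rd t i‖ / κr) ^ 2 = 1 / κr * (‖rd t i‖ ^ 2 / κr) := by field_simp
    have h7 : (‖cyclicDiff (m t) i‖ * Cg) ^ 2
        = Cg ^ 2 / c₁ * (c₁ * ‖cyclicDiff (m t) i‖ ^ 2) := by field_simp
    have h8 : ‖cyclicDiff (r t) i‖ ^ 2 ≤ 2 * (S₁ t + S₂ t) * A := by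
      rw [h6, h7] at h5
      have h9 : 1 / κr * (‖rd t i‖ ^ 2 / κr) ≤ 1 / κr * S₂ t := by gcongr
      have h10 : Cg ^ 2 / c₁ * (c₁ * ‖cyclicDiff (m t) i‖ ^ 2) ≤ Cg ^ 2 / c₁ * S₁ t := by gcongr
      have h11 : 0 ≤ 1 / κr * S₁ t := mul_nonneg (by positivity) (hS₁n t)
      have h12 : 0 ≤ Cg ^ 2 / c₁ * S₂ t := mul_nonneg (by positivity) (hS₂n t)
      rw [hA]
      linarith
    have h9 := div_le_of_le_mul₀ hA0.le (by linarith [hS₁n t, hS₂n t]) h8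
    rw [one_div_mul_eq_div]
    linarith
  refine ⟨hDlim i, hφlim, ?_⟩
  have h3 := (hGD.add hElim).const_smul (-κr)
  rw [add_zero, smul_zero] at h3
  exact h3.congr' ((eventually_ge_atTop 0).mono fun t ht => (hrd t ht i).symm)

end

/-! ### Workloads and centroids as sector integrals. -/

noncomputable section

lemma norm_sectorIntegral_le {E : Type*} [NormedAddCommGroup E] [NormedSpace ℝ E] {f : Plane → E}
    (hf : StronglyMeasurable f) {B : ℝ} (hB : ∀ q, ‖f q‖ ≤ B) {R : ℝ} (hR0 : 0 ≤ R)
    {x : Plane × ℝ × ℝ} (hR : ∀ q, R ≤ dist q x.1 → f q = 0) :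
    ‖sectorIntegral f x‖ ≤ R * (B * (2 * Real.pi)) * R := by
  have hB0 : 0 ≤ B := (norm_nonneg _).trans (hB 0)
  have hpi := Real.pi_pos
  rw [sectorIntegral_eq hf hB hR]
  have := norm_setIntegral_le_of_norm_le_const (μ := volume) (s := Set.Ioo 0 R)
    (C := R * (B * (2 * Real.pi))) (f := arcIntegral f x.1 x) (by simp) (fun κ hκ =>
      (norm_arcIntegral_le hB x.1 hκ.1.le x).trans (by gcongr; exact hκ.2.le))
  simpa [hR0] using this

variable {N : ℕ} [NeZero N]

lemma add_one_ne_self_of_two_le (hN : 2 ≤ N) (i : Fin N) : i + 1 ≠ i := by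
  obtain ⟨n, rfl⟩ : ∃ n, N = n + 2 := ⟨N - 2, by omega⟩
  simp

lemma sub_one_ne_self_of_two_le (hN : 2 ≤ N) (i : Fin N) : i - 1 ≠ i := by
  have := add_one_ne_self_of_two_le hN (i - 1)
  rw [sub_add_cancel] at this
  exact this.symm

lemma sum_gap (φ : Fin N → ℝ) : ∑ i, (nextAngle φ i - φ i) = 2 * Real.pi := by
  have hlt : N - 1 < N := Nat.sub_lt (NeZero.pos N) one_pos
  have h1 : ∀ i : Fin N, nextAngle φ i - φ i
      = φ (i + 1) - φ i + if i = ⟨N - 1, hlt⟩ then 2 * Real.pi else 0 := by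
    intro i
    have h2 : (i : ℕ) + 1 = N ↔ i = ⟨N - 1, hlt⟩ := by
      rw [Fin.ext_iff]
      simp only
      omega
    simp only [nextAngle, h2]
    split_ifs <;> ring
  simp only [h1, Finset.sum_add_distrib, Finset.sum_sub_distrib, sum_shift φ]
  simp

/-- The gaps are positive and add up to `2π`, and a second agent takes a positive share. -/
lemma nextAngle_lt (hN : 2 ≤ N) {φ : Fin N → ℝ} (h : ∀ i, φ i < nextAngle φ i) (i : Fin N) :
    nextAngle φ i < φ i + 2 * Real.pi := by
  have := Finset.single_lt_sum (f := fun i => nextAngle φ i - φ i) (s := Finset.univ)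
    (add_one_ne_self_of_two_le hN i) (Finset.mem_univ i) (Finset.mem_univ (i + 1))
    (sub_pos.2 (h _)) (fun k _ _ => (sub_pos.2 (h k)).le)
  rw [sum_gap] at this
  linarith

/-- The apex and the two angles of the sector of agent `i`. -/
def sectorData (φ : Fin N → ℝ) (r : Fin N → Plane) (i : Fin N) : Plane × ℝ × ℝ :=
  (r i, φ i, nextAngle φ i)

/-- The density extended by zero outside the coverage region. -/
def massDensity (L ρ : Plane → ℝ) : Plane → ℝ := (coverageRegion L).indicator ρ

/-- The density of the first moment, extended by zero outside the coverage region. -/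
def momentDensity (L ρ : Plane → ℝ) : Plane → Plane :=
  (coverageRegion L).indicator fun q => ρ q • q

variable {L ρ : Plane → ℝ}

lemma isClosed_coverageRegion (hL : Continuous L) : IsClosed (coverageRegion L) :=
  isClosed_le hL continuous_const

lemma workload_eq (φ : Fin N → ℝ) (r : Fin N → Plane) (i : Fin N) (hL : Continuous L) :
    workload L ρ φ r i = sectorIntegral (massDensity L ρ) (sectorData φ r i) := by
  rw [workload, sectorIntegral, massDensity,
    setIntegral_indicator (isClosed_coverageRegion hL).measurableSet, Set.inter_comm]
  rfl

lemma centroid_eq (φ : Fin N → ℝ) (r : Fin N → Plane) (i : Fin N) (hL : Continuous L) :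
    centroid L ρ φ r i = (sectorIntegral (massDensity L ρ) (sectorData φ r i))⁻¹ •
      sectorIntegral (momentDensity L ρ) (sectorData φ r i) := by
  rw [centroid, workload_eq φ r i hL, sectorIntegral, sectorIntegral, momentDensity,
    setIntegral_indicator (isClosed_coverageRegion hL).measurableSet, Set.inter_comm]
  rfl

/-- Off the closed set `Ω` the extension by zero is locally zero, and inside `Ω` it is locally `g`;
only boundary points could break continuity. -/
lemma RegularPointer.continuousAt_indicator {F : Type*} [NormedAddCommGroup F]
    (hL : Continuous L) {p : Plane} {θ : ℝ} (h : RegularPointer L ρ p θ) {g : Plane → F}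
    (hg : ∀ q, ContinuousAt ρ q → ContinuousAt g q) (R : ℝ) :
    ∀ᵐ κ ∂(volume.restrict (Set.Ioo 0 R)),
      ContinuousAt ((coverageRegion L).indicator g) (pointer p θ κ) := by
  have hsub : Set.Ioo 0 R ⊆ Set.Ici (0 : ℝ) := fun x hx => hx.1.le
  filter_upwards [ae_restrict_of_ae_restrict_of_subset hsub h] with κ hκ
  rcases hκ with hκ | ⟨h1, h2⟩
  · refine (continuousAt_const (y := (0 : F))).congr ?_
    filter_upwards [(isClosed_coverageRegion hL).isOpen_compl.mem_nhds hκ] with q hq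
    exact (Set.indicator_of_notMem hq _).symm
  · refine (hg _ h2).congr ?_
    filter_upwards [mem_interior_iff_mem_nhds.1 h1] with q hq
    exact (Set.indicator_of_mem hq _).symm

lemma nextAngle_update_self (hN : 2 ≤ N) (φ : Fin N → ℝ) (i : Fin N) (s : ℝ) :
    nextAngle (Function.update φ i s) i = nextAngle φ i := by
  simp [nextAngle, Function.update_of_ne (add_one_ne_self_of_two_le hN i)]

lemma nextAngle_update_pred (φ : Fin N → ℝ) (i : Fin N) (s : ℝ) :
    nextAngle (Function.update φ i s) (i - 1) = s + (nextAngle φ (i - 1) - φ i) := by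
  unfold nextAngle
  simp only [sub_add_cancel, Function.update_self]
  split_ifs <;> ring

/-- The partial derivatives in the dynamics are `deriv` and `gradient`, which default to zero where
differentiability fails. Fréchet differentiability of the sector integral excludes this and
identifies them with values of `sectorDeriv`. -/
lemma workloadAngleDeriv_self (hN : 2 ≤ N) (hL : Continuous L) (φ : Fin N → ℝ)
    (r : Fin N → Plane) (i : Fin N) {R : ℝ}
    (h : HasFDerivAt (sectorIntegral (massDensity L ρ))
      (sectorDeriv (massDensity L ρ) R (sectorData φ r i)) (sectorData φ r i)) :
    workloadAngleDeriv L ρ φ r i i = sectorDeriv (massDensity L ρ) R (sectorData φ r i) (0, 1, 0) := by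
  have h1 : HasDerivAt (fun s : ℝ => ((r i, s, nextAngle φ i) : Plane × ℝ × ℝ)) (0, 1, 0) (φ i) :=
    (hasDerivAt_const _ _).prodMk ((hasDerivAt_id _).prodMk (hasDerivAt_const _ _))
  have h2 := (HasFDerivAt.comp_hasDerivAt (φ i) h h1).deriv
  rw [← h2, workloadAngleDeriv]
  congr 1
  funext s
  rw [workload_eq _ _ _ hL, sectorData, nextAngle_update_self hN, Function.update_self]
  rfl

lemma workloadAngleDeriv_pred (hN : 2 ≤ N) (hL : Continuous L) (φ : Fin N → ℝ)
    (r : Fin N → Plane) (i : Fin N) {R : ℝ}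
    (h : HasFDerivAt (sectorIntegral (massDensity L ρ))
      (sectorDeriv (massDensity L ρ) R (sectorData φ r (i - 1))) (sectorData φ r (i - 1))) :
    workloadAngleDeriv L ρ φ r (i - 1) i
      = sectorDeriv (massDensity L ρ) R (sectorData φ r (i - 1)) (0, 0, 1) := by
  have h1 : HasDerivAt (fun s : ℝ => ((r (i - 1), φ (i - 1), s + (nextAngle φ (i - 1) - φ i)) :
      Plane × ℝ × ℝ)) (0, 0, 1) (φ i) :=
    (hasDerivAt_const _ _).prodMk ((hasDerivAt_const _ _).prodMk
      ((hasDerivAt_id _).add_const _))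
  have hx : sectorData φ r (i - 1)
      = (r (i - 1), φ (i - 1), φ i + (nextAngle φ (i - 1) - φ i)) := by
    rw [add_sub_cancel]; rfl
  have h' := h
  rw [hx] at h'
  have h2 := (HasFDerivAt.comp_hasDerivAt (φ i) h' h1).deriv
  rw [hx, ← h2, workloadAngleDeriv]
  congr 1
  funext s
  rw [workload_eq _ _ _ hL, sectorData, nextAngle_update_pred,
    Function.update_of_ne (sub_one_ne_self_of_two_le hN i)]
  rfl

lemma inner_workloadPointGrad (hL : Continuous L) (φ : Fin N → ℝ)
    (r : Fin N → Plane) (i : Fin N) {R : ℝ}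
    (h : HasFDerivAt (sectorIntegral (massDensity L ρ))
      (sectorDeriv (massDensity L ρ) R (sectorData φ r i)) (sectorData φ r i)) (v : Plane) :
    inner ℝ (workloadPointGrad L ρ φ r i) v
      = sectorDeriv (massDensity L ρ) R (sectorData φ r i) (v, 0, 0) := by
  have h1 : HasFDerivAt (fun p : Plane => ((p, φ i, nextAngle φ i) : Plane × ℝ × ℝ))
      (ContinuousLinearMap.inl ℝ Plane (ℝ × ℝ)) (r i) := by
    exact hasFDerivAt_prodMk_left (r i) (φ i, nextAngle φ i)
  have h2 := HasFDerivAt.comp (r i) h h1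
  have h3 : (fun p : Plane => workload L ρ φ (Function.update r i p) i)
      = sectorIntegral (massDensity L ρ) ∘ fun p : Plane => (p, φ i, nextAngle φ i) := by
    funext p
    rw [workload_eq _ _ _ hL, sectorData, Function.update_self]
    rfl
  rw [← h3] at h2
  rw [workloadPointGrad, h2.hasGradientAt.gradient, InnerProductSpace.toDual_symm_apply]
  rfl

lemma sectorDeriv_split {E : Type*} [NormedAddCommGroup E] [NormedSpace ℝ E] (f : Plane → E)
    (R : ℝ) (x : Plane × ℝ × ℝ) (v : Plane) (α β : ℝ) :
    sectorDeriv f R x (v, α, β) = sectorDeriv f R x (v, 0, 0) + α • sectorDeriv f R x (0, 1, 0)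
      + β • sectorDeriv f R x (0, 0, 1) := by
  rw [← map_smul, ← map_smul, ← map_add, ← map_add]
  simp

lemma hasDerivWithinAt_nextAngle {φ : ℝ → Fin N → ℝ} {φ' : Fin N → ℝ} {s : Set ℝ} {t : ℝ}
    (h : ∀ i, HasDerivWithinAt (fun τ => φ τ i) (φ' i) s t) (i : Fin N) :
    HasDerivWithinAt (fun τ => nextAngle (φ τ) i) (φ' (i + 1)) s t := by
  unfold nextAngle
  split_ifs
  · exact (h (i + 1)).add_const _
  · exact h (i + 1)

/-- If the cyclic second differences tend to zero, then all terms approach their mean. -/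
lemma eventually_ge_of_tendsto_cyclicDiff {m : ℝ → Fin N → ℝ} {μ : ℝ} (hμ : 0 < μ)
    (hm : ∀ i, Tendsto (fun t => cyclicDiff (m t) i) atTop (𝓝 0))
    (hsum : ∀ t, 0 ≤ t → N * μ ≤ ∑ i, m t i) (i : Fin N) :
    ∀ᶠ t in atTop, μ / 2 ≤ m t i := by
  obtain ⟨C, hC, hCyc⟩ := exists_cyclic_bound N one_pos zero_le_one
  have hN : (0 : ℝ) < N := Nat.cast_pos.2 (NeZero.pos N)
  have hX : Tendsto (fun t => C * (C * ∑ j, |cyclicDiff (m t) j|)) atTop (𝓝 0) := by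
    have h := tendsto_finsetSum (Finset.univ : Finset (Fin N)) fun j _ => (hm j).abs
    simpa using (h.const_mul C).const_mul C
  filter_upwards [hX.eventually_lt_const (half_pos hμ), eventually_ge_atTop 0] with t ht ht0
  set X : ℝ := ∑ j, |cyclicDiff (m t) j| with hXdef
  have hX0 : 0 ≤ X := Finset.sum_nonneg fun _ _ => abs_nonneg _
  -- The cyclic bound with unit weights is used twice: here second differences control first
  -- differences, and below first differences control deviations from the mean.
  have h1 := hCyc (fun j => m t j - m t (j + 1)) (fun _ => 1) (fun _ => 1) X hX0
    (fun _ => le_rfl) (fun _ => ⟨zero_le_one, le_rfl⟩)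
    (by rw [Finset.sum_sub_distrib, sum_shift, sub_self])
    (fun j => by
      refine le_trans (le_of_eq ?_) (Finset.single_le_sum
        (f := fun j => |cyclicDiff (m t) j|) (fun _ _ => abs_nonneg _) (Finset.mem_univ j))
      simp only [cyclicDiff, sub_add_cancel, smul_eq_mul]
      congr 1
      ring)
  set M : ℝ := (∑ j, m t j) / N with hM
  have hμM : μ ≤ M := by rw [hM, le_div_iff₀ hN, mul_comm]; exact hsum t ht0
  have h2 := hCyc (fun j => m t j - M) (fun _ => 1) (fun _ => 1) (C * X) (by positivity)
    (fun _ => le_rfl) (fun _ => ⟨zero_le_one, le_rfl⟩)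
    (by
      rw [Finset.sum_sub_distrib, hM]
      simp only [Finset.sum_const, Finset.card_univ, Fintype.card_fin, nsmul_eq_mul]
      field_simp
      ring)
    (fun j => by
      have h := h1 (j - 1)
      rw [abs_sub_comm] at h
      simp only [sub_add_cancel] at h
      simpa using h) i
  have := (abs_le.1 h2).1
  linarith

end

/-! ### Convergence of the centroid velocities. -/

theorem corollary1 (N : ℕ) [NeZero N] (hN : 2 ≤ N)
    (L : Plane → ℝ) (hL : Continuous L) (hΩ : Bornology.IsBounded (coverageRegion L))
    (ρ : Plane → ℝ) (hρm : Measurable ρ) (ρmin ρmax : ℝ) (hρmin : 0 < ρmin)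
    (hρ : ∀ q ∈ coverageRegion L, ρmin ≤ ρ q ∧ ρ q ≤ ρmax)
    (κφ κr : ℝ) (hκφ : 0 < κφ) (hκr : 0 < κr)
    (φ : ℝ → Fin N → ℝ) (r : ℝ → Fin N → Plane)
    (hsol : IsPartitionSolution L ρ κφ κr φ r)
    -- the pointers keep their cyclic order, so the subregions are nondegenerate
    (horder : ∀ t : ℝ, 0 ≤ t → ∀ i : Fin N, φ t i < nextAngle (φ t) i)
    -- the reference points stay in a compact part of the interior of the coverage region
    (hinside : ∃ K : Set Plane, IsCompact K ∧ K ⊆ interior (coverageRegion L) ∧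
      ∀ t : ℝ, 0 ≤ t → ∀ i : Fin N, r t i ∈ K)
    -- both partition bars of every agent are regular
    (hreg : ∀ t : ℝ, 0 ≤ t → ∀ i : Fin N,
      RegularPointer L ρ (r t i) (φ t i) ∧ RegularPointer L ρ (r t i) (nextAngle (φ t) i)) :
    ∀ i : Fin N, ∃ c' : ℝ → Plane,
      (∀ t : ℝ, 0 ≤ t →
        HasDerivWithinAt (fun s => centroid L ρ (φ s) (r s) i) (c' t) (Set.Ici 0) t) ∧
      Tendsto c' atTop (𝓝 0) := by
  obtain ⟨K, hK, hKint, hrK⟩ := hinside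
  -- One radius `δ` serves all agents and all times: every disc of this radius about a reference
  -- point lies in `Ω`. All uniform lower bounds come from it.
  obtain ⟨δ, hδ, hδK⟩ := hK.exists_cthickening_subset_open isOpen_interior hKint
  obtain ⟨M, hM0, hM⟩ := hΩ.exists_pos_norm_le
  have hpi := Real.pi_pos
  have hΩmeas := (isClosed_coverageRegion hL).measurableSet
  have hrΩ : ∀ t, 0 ≤ t → ∀ i, r t i ∈ coverageRegion L := fun t ht i =>
    interior_subset (hKint (hrK t ht i))
  have hρmax : 0 ≤ ρmax := by
    obtain ⟨h1, h2⟩ := hρ _ (hrΩ 0 le_rfl 0)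
    linarith
  -- Points of `Ω` are at most `2M` apart; the `1` makes `R` strictly larger, and the `δ` gives `δ ≤
  -- R`.
  set R : ℝ := 2 * M + 1 + δ with hR
  have hR0 : 0 ≤ R := by positivity
  have hδR : δ ≤ R := by linarith
  have hout : ∀ p ∈ coverageRegion L, ∀ q, R ≤ dist q p → q ∉ coverageRegion L := by
    intro p hp q hq hqΩ
    have := dist_le_norm_add_norm q p
    have := hM p hp
    have := hM q hqΩ
    linarith
  set f₁ := massDensity L ρ with hf₁
  set f₂ := momentDensity L ρ with hf₂
  have hf₁m : StronglyMeasurable f₁ := hρm.stronglyMeasurable.indicator hΩmeas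
  have hf₂m : StronglyMeasurable f₂ :=
    (hρm.stronglyMeasurable.smul measurable_id.stronglyMeasurable).indicator hΩmeas
  have hf₁B : ∀ q, ‖f₁ q‖ ≤ ρmax := fun q => by
    by_cases hq : q ∈ coverageRegion L
    · rw [hf₁, massDensity, Set.indicator_of_mem hq,
        Real.norm_of_nonneg (hρmin.le.trans (hρ q hq).1)]
      exact (hρ q hq).2
    · rwa [hf₁, massDensity, Set.indicator_of_notMem hq, norm_zero]
  have hf₂B : ∀ q, ‖f₂ q‖ ≤ ρmax * M := fun q => by
    by_cases hq : q ∈ coverageRegion L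
    · rw [hf₂, momentDensity, Set.indicator_of_mem hq, norm_smul,
        Real.norm_of_nonneg (hρmin.le.trans (hρ q hq).1)]
      exact mul_le_mul (hρ q hq).2 (hM q hq) (norm_nonneg _) hρmax
    · rw [hf₂, momentDensity, Set.indicator_of_notMem hq, norm_zero]
      positivity
  have hf₁0 : ∀ q, 0 ≤ f₁ q := fun q =>
    Set.indicator_nonneg (fun q hq => hρmin.le.trans (hρ q hq).1) q
  have hf₁R : ∀ t, 0 ≤ t → ∀ i q, R ≤ dist q (r t i) → f₁ q = 0 := fun t ht i q hq =>
    Set.indicator_of_notMem (hout _ (hrΩ t ht i) q hq) _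
  have hf₂R : ∀ t, 0 ≤ t → ∀ i q, R ≤ dist q (r t i) → f₂ q = 0 := fun t ht i q hq =>
    Set.indicator_of_notMem (hout _ (hrΩ t ht i) q hq) _
  have hf₁δ : ∀ t, 0 ≤ t → ∀ i q, dist q (r t i) < δ → ρmin ≤ f₁ q := fun t ht i q hq => by
    have hqΩ : q ∈ coverageRegion L := interior_subset
      (hδK (Metric.mem_cthickening_of_dist_le q (r t i) δ K (hrK t ht i) hq.le))
    rw [hf₁, massDensity, Set.indicator_of_mem hqΩ]
    exact (hρ q hqΩ).1
  have hlt : ∀ t, 0 ≤ t → ∀ i, nextAngle (φ t) i < φ t i + 2 * Real.pi := fun t ht =>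
    nextAngle_lt hN (horder t ht)
  have hd₁ : ∀ t, 0 ≤ t → ∀ i, HasFDerivAt (sectorIntegral f₁)
      (sectorDeriv f₁ R (sectorData (φ t) (r t) i)) (sectorData (φ t) (r t) i) := fun t ht i =>
    hasFDerivAt_sectorIntegral hf₁m hf₁B (hf₁R t ht i) (horder t ht i) (hlt t ht i)
      ((hreg t ht i).1.continuousAt_indicator hL (fun _ h => h) R)
      ((hreg t ht i).2.continuousAt_indicator hL (fun _ h => h) R)
  have hd₂ : ∀ t, 0 ≤ t → ∀ i, HasFDerivAt (sectorIntegral f₂)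
      (sectorDeriv f₂ R (sectorData (φ t) (r t) i)) (sectorData (φ t) (r t) i) := fun t ht i =>
    hasFDerivAt_sectorIntegral hf₂m hf₂B (hf₂R t ht i) (horder t ht i) (hlt t ht i)
      ((hreg t ht i).1.continuousAt_indicator hL (fun _ h => h.smul continuousAt_id) R)
      ((hreg t ht i).2.continuousAt_indicator hL (fun _ h => h.smul continuousAt_id) R)
  -- the velocities
  obtain ⟨φd, hφd⟩ : ∃ φd : ℝ → Fin N → ℝ, ∀ t i, φd t i =
      -κφ * (workloadDiff L ρ (φ t) (r t) i * workloadAngleDeriv L ρ (φ t) (r t) i i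
        + workloadDiff L ρ (φ t) (r t) (i - 1)
          * workloadAngleDeriv L ρ (φ t) (r t) (i - 1) i) := ⟨_, fun _ _ => rfl⟩
  obtain ⟨rd, hrd⟩ : ∃ rd : ℝ → Fin N → Plane, ∀ t i, rd t i =
      -κr • (workloadDiff L ρ (φ t) (r t) i • workloadPointGrad L ρ (φ t) (r t) i
        + ((2 : ℝ) • r t i - r t (i - 1) - r t (i + 1))) := ⟨_, fun _ _ => rfl⟩
  have hφ' : ∀ t, 0 ≤ t → ∀ i, HasDerivWithinAt (fun s => φ s i) (φd t i) (Set.Ici 0) t :=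
    fun t ht i => (hsol.angle t ht i).congr_deriv (hφd t i).symm
  have hr' : ∀ t, 0 ≤ t → ∀ i, HasDerivWithinAt (fun s => r s i) (rd t i) (Set.Ici 0) t :=
    fun t ht i => (hsol.point t ht i).congr_deriv (hrd t i).symm
  have hx' : ∀ t, 0 ≤ t → ∀ i, HasDerivWithinAt (fun s => sectorData (φ s) (r s) i)
      (rd t i, φd t i, φd t (i + 1)) (Set.Ici 0) t := fun t ht i =>
    (hr' t ht i).prodMk ((hφ' t ht i).prodMk (hasDerivWithinAt_nextAngle (hφ' t ht) i))
  set m : ℝ → Fin N → ℝ := fun t i => sectorIntegral f₁ (sectorData (φ t) (r t) i) with hm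
  have hmw : ∀ t, m t = workload L ρ (φ t) (r t) := fun t =>
    funext fun i => (workload_eq (φ t) (r t) i hL).symm
  set Md : ℝ → Fin N → Plane × ℝ × ℝ →L[ℝ] ℝ := fun t i =>
    sectorDeriv f₁ R (sectorData (φ t) (r t) i) with hMd
  have hm' : ∀ t, 0 ≤ t → ∀ i, HasDerivWithinAt (fun s => m s i)
      (Md t i (rd t i, φd t i, φd t (i + 1))) (Set.Ici 0) t := fun t ht i =>
    HasFDerivAt.comp_hasDerivWithinAt (l := sectorIntegral f₁) t (hd₁ t ht i) (hx' t ht i)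
  have hMdB : ∀ t i v, ‖Md t i v‖ ≤ 2 * ((R + 1) * ρmax * R) * ‖v‖ := fun t i v =>
    norm_sectorDeriv_apply_le hf₁B hR0 _ v
  -- Advancing the first bar shrinks the sector, hence the sign; `-Ma` and `Mb` then have the same
  -- positive lower bound.
  have hMa : ∀ t i, Md t i (0, 1, 0) = -barDeriv f₁ R (r t i) (φ t i) (0, 1) := fun t i => by
    rw [hMd]
    simp only
    rw [sectorDeriv_apply, show (((0, 1, 0) : Plane × ℝ × ℝ).1, ((0, 1, 0) : Plane × ℝ × ℝ).2.2)
      = (0 : Plane × ℝ) from rfl, map_zero, zero_sub]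
    rfl
  have hMb : ∀ t i, Md t i (0, 0, 1) = barDeriv f₁ R (r t i) (nextAngle (φ t) i) (0, 1) :=
    fun t i => by
    rw [hMd]
    simp only
    rw [sectorDeriv_apply, show (((0, 0, 1) : Plane × ℝ × ℝ).1, ((0, 0, 1) : Plane × ℝ × ℝ).2.1)
      = (0 : Plane × ℝ) from rfl, map_zero, sub_zero]
    rfl
  have hgrad : ∀ t, 0 ≤ t → ∀ i v, inner ℝ (workloadPointGrad L ρ (φ t) (r t) i) v
      = Md t i (v, 0, 0) := fun t ht i v =>
    inner_workloadPointGrad hL (φ t) (r t) i (hd₁ t ht i) v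
  have hgap : ∀ t, 0 ≤ t → ∀ i,
      ρmin * (nextAngle (φ t) i - φ t i) * (δ ^ 2 / 2) ≤ m t i := fun t ht i =>
    le_sectorIntegral hf₁m hf₁B hf₁0 (hf₁R t ht i) hδ.le hδR (hf₁δ t ht i) (horder t ht i).le
      (hlt t ht i)
  have hmpos : ∀ t, 0 ≤ t → ∀ i, 0 < m t i := fun t ht i =>
    lt_of_lt_of_le (mul_pos (mul_pos hρmin (sub_pos.2 (horder t ht i))) (by positivity))
      (hgap t ht i)
  have hnorm : ‖((0, 1, 0) : Plane × ℝ × ℝ)‖ = 1 ∧ ‖((0, 0, 1) : Plane × ℝ × ℝ)‖ = 1 := by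
    constructor <;> simp [Prod.norm_def]
  -- all velocities tend to zero
  have hlim := tendsto_zero_of_cyclic_descent (κφ := κφ) (κr := κr) (g₀ := ρmin * (δ ^ 2 / 2))
    (g₁ := 2 * ((R + 1) * ρmax * R)) (Cg := 2 * ((R + 1) * ρmax * R))
    (Cm := R * (ρmax * (2 * Real.pi)) * R) (Cr := M)
    (m := m) (Ma := fun t i => Md t i (0, 1, 0)) (Mb := fun t i => Md t i (0, 0, 1))
    (φd := φd) (r := r) (G := fun t i => workloadPointGrad L ρ (φ t) (r t) i) (rd := rd)
    hκφ hκr (by positivity) (by positivity)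
    (fun t ht i => by
      rw [hφd, workloadAngleDeriv_self hN hL _ _ _ (hd₁ t ht i),
        workloadAngleDeriv_pred hN hL _ _ _ (hd₁ t ht (i - 1)), hmw]
      rfl)
    (fun t ht i => by
      rw [hrd, hmw]
      rfl)
    (fun t ht i => by
      refine (hm' t ht i).congr_deriv ?_
      rw [hgrad t ht, hMd]
      simp only
      rw [sectorDeriv_split, smul_eq_mul, smul_eq_mul, mul_comm (φd t i),
        mul_comm (φd t (i + 1))])
    hr'
    (fun t ht i => by
      refine ⟨?_, ?_⟩
      · rw [hMa, neg_neg]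
        exact le_barDeriv_angle hf₁m hf₁B hf₁0 hδ.le hδR (hf₁δ t ht i) _
      · have h := (neg_le_abs _).trans (hMdB t i (0, 1, 0))
        rwa [hnorm.1, mul_one] at h)
    (fun t ht i => by
      refine ⟨?_, ?_⟩
      · rw [hMb]
        exact le_barDeriv_angle hf₁m hf₁B hf₁0 hδ.le hδR (hf₁δ t ht i) _
      · have h := (le_abs_self _).trans (hMdB t i (0, 0, 1))
        rwa [hnorm.2, mul_one] at h)
    -- Testing the derivative on the gradient itself gives `‖G‖² ≤ C ‖G‖`.
    (fun t ht i => by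
      set G := workloadPointGrad L ρ (φ t) (r t) i with hG
      have h1 := (le_abs_self _).trans (hMdB t i (G, 0, 0))
      rw [← hgrad t ht i G, ← hG, real_inner_self_eq_norm_sq,
        show ‖((G, 0, 0) : Plane × ℝ × ℝ)‖ = ‖G‖ by simp [Prod.norm_def]] at h1
      by_contra hcon
      push Not at hcon
      have h2 : 0 < ‖G‖ := lt_of_le_of_lt (by positivity) hcon
      nlinarith)
    (fun t ht i => norm_sectorIntegral_le hf₁m hf₁B hR0 (hf₁R t ht i))
    (fun t ht i => hM _ (hrΩ t ht i))
  intro i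
  have hv : Tendsto (fun t => ((rd t i, φd t i, φd t (i + 1)) : Plane × ℝ × ℝ)) atTop (𝓝 0) :=
    ((hlim i).2.2).prodMk_nhds (((hlim i).2.1).prodMk_nhds ((hlim (i + 1)).2.1))
  -- Uniform boundedness of the linear maps is enough; they need not converge or vary continuously
  -- in time.
  have hvz : ∀ {F : Type} [NormedAddCommGroup F] [NormedSpace ℝ F]
      (T : ℝ → Plane × ℝ × ℝ →L[ℝ] F) (C : ℝ), (∀ t v, ‖T t v‖ ≤ C * ‖v‖) →
      Tendsto (fun t => T t (rd t i, φd t i, φd t (i + 1))) atTop (𝓝 0) := by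
    intro F _ _ T C hT
    refine squeeze_zero_norm (fun t => hT t _) ?_
    simpa using hv.norm.const_mul C
  have hm'lim := hvz (fun t => Md t i) _ fun t => hMdB t i
  set Td : ℝ → Plane × ℝ × ℝ →L[ℝ] Plane := fun t =>
    sectorDeriv f₂ R (sectorData (φ t) (r t) i) with hTd
  have hTlim := hvz Td _ fun t => norm_sectorDeriv_apply_le hf₂B hR0 _
  set T : ℝ → Plane := fun t => sectorIntegral f₂ (sectorData (φ t) (r t) i) with hT
  have hT' : ∀ t, 0 ≤ t → HasDerivWithinAt T (Td t (rd t i, φd t i, φd t (i + 1)))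
      (Set.Ici 0) t := fun t ht =>
    HasFDerivAt.comp_hasDerivWithinAt (l := sectorIntegral f₂) t (hd₂ t ht i) (hx' t ht i)
  have hTB : ∀ t, 0 ≤ t → ‖T t‖ ≤ R * (ρmax * M * (2 * Real.pi)) * R := fun t ht =>
    norm_sectorIntegral_le hf₂m hf₂B hR0 (hf₂R t ht i)
  -- the workloads are bounded below
  obtain ⟨μ, hμ, hmμ⟩ : ∃ μ : ℝ, 0 < μ ∧ ∀ᶠ t in atTop, μ ≤ m t i := by
    have hN0 : (0 : ℝ) < N := Nat.cast_pos.2 (NeZero.pos N)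
    -- A single gap has no lower bound that is uniform in time, but the sum of the gaps is `2π`.
    -- Adding the sector bounds therefore bounds the mean workload below, without the subregions
    -- having to tile `Ω`.
    have hμ : 0 < ρmin * (2 * Real.pi) * (δ ^ 2 / 2) / N := by positivity
    refine ⟨_, half_pos hμ, eventually_ge_of_tendsto_cyclicDiff hμ (fun j => (hlim j).1)
      (fun t ht => ?_) i⟩
    have h := Finset.sum_le_sum fun j (_ : j ∈ Finset.univ) => hgap t ht j
    rw [← Finset.sum_mul, ← Finset.mul_sum, sum_gap] at h
    rwa [mul_div_cancel₀ _ hN0.ne']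
  set md : ℝ → ℝ := fun t => Md t i (rd t i, φd t i, φd t (i + 1)) with hmd
  set Tv : ℝ → Plane := fun t => Td t (rd t i, φd t i, φd t (i + 1)) with hTv
  -- This is the quotient rule. Differentiability needs `m_i > 0` at each time; the limit uses only
  -- the eventual bound `μ ≤ m_i`.
  refine ⟨fun t => (m t i)⁻¹ • Tv t + (-md t / m t i ^ 2) • T t, fun t ht => ?_, ?_⟩
  · have h := ((hm' t ht i).inv (hmpos t ht i).ne').smul (hT' t ht)
    refine h.congr_of_eventuallyEq (Eventually.of_forall fun s => ?_) ?_
    · exact centroid_eq (φ s) (r s) i hL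
    · exact centroid_eq (φ t) (r t) i hL
  · have hinv : ∀ᶠ t in atTop, ‖(m t i)⁻¹‖ ≤ μ⁻¹ := by
      filter_upwards [hmμ] with t ht
      rw [norm_inv, Real.norm_of_nonneg (hμ.le.trans ht)]
      exact inv_anti₀ hμ ht
    have h1 : Tendsto (fun t => (m t i)⁻¹ • Tv t) atTop (𝓝 0) :=
      (isBoundedUnder_of_eventually_le hinv).smul_tendsto_zero hTlim
    have h2 : Tendsto (fun t => (-md t / m t i ^ 2) • T t) atTop (𝓝 0) := by
      have h3 : Tendsto (fun t => -md t * (m t i ^ 2)⁻¹) atTop (𝓝 0) := by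
        have h4 : Tendsto (fun t => -md t) atTop (𝓝 0) := by simpa using hm'lim.neg
        refine h4.zero_mul_isBoundedUnder_le
          (isBoundedUnder_of_eventually_le (a := μ⁻¹ ^ 2) ?_)
        filter_upwards [hinv] with t ht
        simp only [Function.comp]
        rw [← inv_pow, norm_pow]
        exact pow_le_pow_left₀ (norm_nonneg _) ht 2
      exact h3.zero_smul_isBoundedUnder_le (isBoundedUnder_of_eventually_le
        ((eventually_ge_atTop 0).mono hTB))
    simpa using h1.add h2
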